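/- Let $p\ge 2$ and let $G=(V,E)$ be a directed tree on $V=\{1,\dots,p\}$: its skeleton (underlying undirected graph) is a tree, every edge $i\to j$ satisfies $i<j$, and there are no colliders $i\to k\leftarrow j$ with $i\neq j$ (equivalently, all edges point away from a root). Let $m$ be the length (number of edges) of the longest undirected path in $G$. For $a\in\mathbb{R}^E$ let $A_G$ be the $p\times p$ matrix with entry $a_{ij}$ at position $(i,j)$ if $i\to j$ is an edge and $0$ otherwise, and consider the Gaussian model $X=A_G^TX+\epsilon$, $\epsilon\sim\mathcal N(0,I)$, with concentration matrix $K=(A_G-I)(A_G-I)^T$. For $S\subset V$, distinct $i,j\in V\setminus S$ and $R=V\setminus(S\cup\{i,j\})$, the partial correlation is, up to sign, $$\operatorname{corr}(i,j|S)=\frac{\det(K_{iR,jR})}{\sqrt{\det(K_{iR,iR})\det(K_{jR,jR})}} .$$ For $\lambda\in[0,1]$, a parameter $a$ is $\lambda$-strong-faithful to $G$ if for all $S\subset V$ and all distinct $i,j\in V\setminus S$ one has $|\operatorname{corr}(i,j|S)|\le\lambda$ if and only if $i$ and $j$ are d-separated given $S$ in $G$. (That is, there is no undirected path from $i$ to $j$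 on which every non-collider is outside $S$ and every collider is in $S$ or an ancestor of a node in $S$.) Let $\Omega=[-1,1]^E$ and let $\varphi:\Omega\to\mathbb{R}$ be a strictly positive real-analytic probability density with respect to Lebesgue measure. Put $$V_G(\lambda)=\int_{\{a\in\Omega\,:\,a\text{ is not }\lambda\text{-strong-faithful to }G\}}\varphi(a)\,da .$$ **Theorem.** There is a constant $C>0$ (depending only on $G$ and $\varphi$) such that $V_G(\lambda)\approx C\lambda(-\ln\lambda)^{m-1}$ as $\lambda\to0^+$, that is, $$\lim_{\lambda\to0^+}\frac{V_G(\lambda)-C\lambda(-\ln\lambda)^{m-1}}{C\lambda(-\ln\lambda)^{m-1}}=0 .$$ -/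

import Mathlib

open Filter Topology MeasureTheory

/-- A directed acyclic graph on the vertices `0, …, p - 1`, topologically ordered: every directed
edge `i → j` satisfies `i < j` (so there are no directed cycles). -/
structure OrderedDAG (p : ℕ) where
  /-- `Adj i j` means that there is a directed edge `i → j`. -/
  Adj : Fin p → Fin p → Prop
  lt_of_adj : ∀ i j, Adj i j → i < j

namespace OrderedDAG

variable {p : ℕ} (G : OrderedDAG p)

/-- The set of directed edges, which indexes the parameters of the model. -/
abbrev Edge : Type := {e : Fin p × Fin p // G.Adj e.1 e.2}

noncomputable instance instFintypeEdge : Fintype G.Edge := Fintype.ofFinite _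

/-- The underlying undirected graph. -/
def skeleton : SimpleGraph (Fin p) where
  Adj i j := G.Adj i j ∨ G.Adj j i
  symm := ⟨fun _ _ h => h.symm⟩
  loopless := ⟨fun i h => h.elim (fun h' => lt_irrefl i (G.lt_of_adj i i h'))
    (fun h' => lt_irrefl i (G.lt_of_adj i i h'))⟩

/-- A directed tree: the skeleton is a tree and there is no collider `i → k ← j` with `i ≠ j`
(equivalently, all edges point away from a root). -/
def IsDirectedTree : Prop :=
  G.skeleton.IsTree ∧ ∀ i j k, G.Adj i k → G.Adj j k → i = j

/-- The lengths of the undirected paths (without repeated vertices) in the graph. -/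
def pathLengths : Set ℕ :=
  {n | ∃ (i j : Fin p) (w : G.skeleton.Walk i j), w.IsPath ∧ w.length = n}

/-- `i` is an ancestor of `j`: there is a directed path `i → ⋯ → j`. -/
def IsAncestor (i j : Fin p) : Prop := Relation.TransGen G.Adj i j

/-- The `k`-th vertex of the walk `w` is a collider on `w`: it is an interior vertex of `w` at
which the two arrowheads of the neighbouring edges of `w` meet. -/
def IsColliderOn {i j : Fin p} (w : G.skeleton.Walk i j) (k : ℕ) : Prop :=
  0 < k ∧ k < w.length ∧ G.Adj (w.getVert (k - 1)) (w.getVert k) ∧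
    G.Adj (w.getVert (k + 1)) (w.getVert k)

/-- The undirected path `w` from `i` to `j` d-connects `i` and `j` given `S`. -/
def DConnects {i j : Fin p} (w : G.skeleton.Walk i j) (S : Finset (Fin p)) : Prop :=
  w.IsPath ∧ ∀ k ≤ w.length,
    (¬ G.IsColliderOn w k → w.getVert k ∉ S) ∧
    (G.IsColliderOn w k → w.getVert k ∈ S ∨ ∃ s ∈ S, G.IsAncestor (w.getVert k) s)

/-- `i` and `j` are d-separated given `S`: no path d-connects them given `S`. -/
def DSeparated (i j : Fin p) (S : Finset (Fin p)) : Prop :=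
  ¬ ∃ w : G.skeleton.Walk i j, G.DConnects w S

open Classical in
/-- The weighted adjacency matrix `A_G`, with entry `a_{ij}` for each edge `i → j`. -/
noncomputable def adjacencyMatrix (a : G.Edge → ℝ) : Matrix (Fin p) (Fin p) ℝ :=
  Matrix.of fun i j => if h : G.Adj i j then a ⟨(i, j), h⟩ else 0

/-- The concentration matrix `K = (A_G - I)(A_G - I)ᵀ` of the structural equation model
`X = A_Gᵀ X + ε` with `ε ∼ N(0, I)`. -/
noncomputable def concentration (a : G.Edge → ℝ) : Matrix (Fin p) (Fin p) ℝ :=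
  (G.adjacencyMatrix a - 1) * (G.adjacencyMatrix a - 1).transpose

end OrderedDAG

/-- The minor `det K_{iR, jR}`: rows `{i} ∪ R`, columns `{j} ∪ R`, where the row `i` and the
column `j` are listed first and `R` is listed in the same order in rows and columns. -/
noncomputable def bordMinor {p : ℕ} (K : Matrix (Fin p) (Fin p) ℝ) (i j : Fin p)
    (R : Finset (Fin p)) : ℝ :=
  (K.submatrix (fun x : Option R => x.elim i (fun r => (r : Fin p)))
    (fun x : Option R => x.elim j (fun r => (r : Fin p)))).det

namespace OrderedDAG

variable {p : ℕ} (G : OrderedDAG p)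

/-- The partial correlation `corr(i, j | S)`, up to sign, as a function of the parameters:
`det K_{iR,jR} / √(det K_{iR,iR} · det K_{jR,jR})` with `R = V ∖ (S ∪ {i, j})`. -/
noncomputable def partialCorr (a : G.Edge → ℝ) (i j : Fin p) (S : Finset (Fin p)) : ℝ :=
  bordMinor (G.concentration a) i j (insert i (insert j S))ᶜ /
    √(bordMinor (G.concentration a) i i (insert i (insert j S))ᶜ *
      bordMinor (G.concentration a) j j (insert i (insert j S))ᶜ)

/-- The Gaussian distribution with parameter `a` is `t`-strong-faithful to `G`. -/
def StrongFaithful (t : ℝ) (a : G.Edge → ℝ) : Prop :=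
  ∀ (S : Finset (Fin p)) (i j : Fin p), i ≠ j → i ∉ S → j ∉ S →
    (|G.partialCorr a i j S| ≤ t ↔ G.DSeparated i j S)

/-- The parameter space `Ω = [-1, 1]^E`. -/
def paramCube : Set (G.Edge → ℝ) := Set.Icc (fun _ => -1) (fun _ => 1)

/-- `V_G(t)`: the mass, for the density `φ` with respect to Lebesgue measure on `Ω`, of the set of
parameters whose distribution is not `t`-strong-faithful to `G`. -/
noncomputable def unfaithfulVolume (φ : (G.Edge → ℝ) → ℝ) (t : ℝ) : ℝ :=
  ∫ a in {a | a ∈ G.paramCube ∧ ¬ G.StrongFaithful t a}, φ a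

end OrderedDAG

/-!
The concentration matrix `K` of a directed tree is positive definite and, since the tree has no
colliders, its off-diagonal entries are `-a e` on the edges of the skeleton and zero elsewhere.
Write a minor `det K_{iR,jR}` as `det K_R` times the entry `(K w)_i`, where `w` solves
`(K w)_r = 0` on `R`, is supported on `R ∪ {j}` and has `w_j = 1`
(`Matrix.PosDef.exists_bordMinor_eq`). Cutting the edge `u v` of a tree decouples the two sides, so
that `w_u = -K_{uv} c w_v` with a conditional variance `c > 0`
(`OrderedDAG.IsDirectedTree.eq_neg_mul_of_adj`). Following the path from `i` to `j`, one finds that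
`|corr(i, j | S)|` is the product of the `|a e|` along the path times a positive continuous function
of `a` if the path avoids `S`, and zero otherwise. Hence the parameters that are not
`t`-strong-faithful form a finite union of sets `∏ e ∈ T, |a e| * h a ≤ t`, one for each d-connected
triple, where `T` is the edge set of a path and `h` is positive and continuous
(`OrderedDAG.IsDirectedTree.not_strongFaithful_iff`).

The mass of such a union is computed with `t = exp (-L)`. For a monomial with `k` factors, the
coordinates `monomialChart`, in which `|a e| = exp (-L * |u e|)` for all but one `e ∈ T` and the
absolute value of the monomial is `exp (-L) * |u e₀|`, have a Jacobian determinant of constant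
absolute value `exp (-L) * L ^ (k - 1)`. In these coordinates the integrand is dominated by a fixed integrable function, so the mass is
`O(exp (-L) * L ^ (k - 1))`, which makes paths shorter than `m` negligible. For `k = m` the
integrand converges almost everywhere: all coordinates in `T` tend to zero, `h` and `φ` may be
evaluated on the face `a e = 0`, `e ∈ T`, and any other monomial of degree at most `m` misses a
factor that tends to zero, so it is eventually far above `exp (-L)` and does not interfere
(`eventually_notMem_monomialSublevel`). Dominated convergence gives the constant
(`exists_tendsto_integral_union`), which is positive because the limiting region is open and
nonempty and `φ` is positive. When several triples share a path, their weights `h` are merged by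
taking the minimum (`exists_tendsto_setIntegral_iUnion`).
-/

/-! ### Positive definite linear systems and bordered minors -/

namespace Matrix

/-- Expanding a bordered minor along its extra row and column: if `w` solves the linear system
`(K w)_r = 0`, `r ∈ R`, normalised by `w_j = 1` and supported on `R ∪ {j}`, then the minor is
`det K_R` times the entry `(K w)_i` (a Schur complement). -/
lemma PosDef.exists_bordMinor_eq {p : ℕ} {K : Matrix (Fin p) (Fin p) ℝ} (hK : K.PosDef)
    (i j : Fin p) (R : Finset (Fin p)) (hj : j ∉ R) :
    ∃ w : Fin p → ℝ, w j = 1 ∧ (∀ x ∉ R, x ≠ j → w x = 0) ∧ (∀ r ∈ R, (K *ᵥ w) r = 0) ∧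
      bordMinor K i j R =
        (K.submatrix (fun r : R => (r : Fin p)) (fun r : R => (r : Fin p))).det * (K *ᵥ w) i := by
  classical
  set A : Matrix R R ℝ := K.submatrix (fun r : R => (r : Fin p)) (fun r : R => (r : Fin p)) with hA
  have hApd : A.PosDef := hK.submatrix Subtype.val_injective
  have hAu : IsUnit A.det := (isUnit_iff_isUnit_det A).mp hApd.isUnit
  let b : R → ℝ := fun r => K r j
  let z : R → ℝ := A⁻¹ *ᵥ b
  let w : Fin p → ℝ := fun x => if h : x ∈ R then - z ⟨x, h⟩ else if x = j then 1 else 0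
  have hwR : ∀ r : R, w r = - z r := fun r => by simp [w]
  have hwj : w j = 1 := by simp [w, hj]
  have hw0 : ∀ x ∉ R, x ≠ j → w x = 0 := fun x hx hxj => by simp [w, hx, hxj]
  have hmul : ∀ x, (K *ᵥ w) x = K x j - ∑ r : R, K x r * z r := by
    intro x
    have h1 : (K *ᵥ w) x = ∑ y, K x y * w y := rfl
    have h2 : ∑ y, K x y * w y = ∑ y ∈ insert j R, K x y * w y := by
      symm
      apply Finset.sum_subset (Finset.subset_univ _)
      intro y _ hy
      rw [Finset.mem_insert, not_or] at hy
      rw [hw0 y hy.2 hy.1, mul_zero]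
    rw [h1, h2, Finset.sum_insert hj, hwj, mul_one, ← Finset.sum_coe_sort R (fun y => K x y * w y)]
    simp only [hwR, mul_neg, Finset.sum_neg_distrib]
    ring
  refine ⟨w, hwj, hw0, ?_, ?_⟩
  · intro r hr
    have h1 : A *ᵥ z = b := by
      simp only [z]
      rw [mulVec_mulVec, mul_nonsing_inv _ hAu, one_mulVec]
    have h2 := congrFun h1 ⟨r, hr⟩
    rw [hmul]
    have h3 : (A *ᵥ z) ⟨r, hr⟩ = ∑ s : R, K r s * z s := rfl
    rw [← h3, h2]
    simp [b]
  · let e := Equiv.optionEquivSumPUnit.{0} R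
    have h1 : bordMinor K i j R = (fromBlocks A (of fun r (_ : PUnit) => K r j)
        (of fun (_ : PUnit) r => K i r) (of fun (_ _ : PUnit) => K i j)).det := by
      unfold bordMinor
      rw [← det_submatrix_equiv_self e.symm]
      congr 1
      ext x y
      rcases x with x | x <;> rcases y with y | y <;> simp [e, A]
    have : Invertible A := hApd.isUnit.invertible
    rw [h1, det_fromBlocks₁₁, hmul, det_unique (n := PUnit)]
    congr 1
    rw [invOf_eq_nonsing_inv, Matrix.mul_assoc]
    rfl

/-- Solving a linear system on a set `Y` of unknowns that is coupled to the remaining ones only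
through the pair `(u, v)`. -/
lemma PosDef.eq_neg_mul_of_mulVec_eq_zero {p : ℕ} {K : Matrix (Fin p) (Fin p) ℝ} (hK : K.PosDef)
    (Y : Finset (Fin p)) {u v : Fin p} (hu : u ∈ Y) (hv : v ∉ Y) (w : Fin p → ℝ)
    (hKw : ∀ y ∈ Y, (K *ᵥ w) y = 0)
    (hcoup : ∀ y ∈ Y, ∀ x ∉ Y, (y = u ∧ x = v) ∨ K y x * w x = 0) :
    w u = - K u v * (K.submatrix (fun r : Y => (r : Fin p)) (fun r : Y => (r : Fin p)))⁻¹
      ⟨u, hu⟩ ⟨u, hu⟩ * w v := by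
  classical
  set A : Matrix Y Y ℝ := K.submatrix (fun r : Y => (r : Fin p)) (fun r : Y => (r : Fin p)) with hA
  have hApd : A.PosDef := hK.submatrix Subtype.val_injective
  have hAu : IsUnit A.det := (isUnit_iff_isUnit_det A).mp hApd.isUnit
  let wY : Y → ℝ := fun y => w y
  have h1 : A *ᵥ wY = Pi.single ⟨u, hu⟩ (- K u v * w v) := by
    funext y
    have h2 := hKw y y.2
    have h3 : (K *ᵥ w) y = ∑ x, K y x * w x := rfl
    rw [h3, ← Finset.sum_add_sum_compl Y, ← Finset.sum_coe_sort Y (fun x => K y x * w x)] at h2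
    have h4 : (A *ᵥ wY) y = ∑ x : Y, K y x * w x := rfl
    rw [h4]
    by_cases hy : y = ⟨u, hu⟩
    · subst hy
      rw [Pi.single_eq_same]
      have h5 : ∑ x ∈ Yᶜ, K u x * w x = K u v * w v := by
        apply Finset.sum_eq_single_of_mem v (by simpa using hv)
        intro x hx hxv
        exact (hcoup u hu x (by simpa using hx)).resolve_left (fun h => hxv h.2)
      simp only at h2
      rw [h5] at h2
      linarith
    · rw [Pi.single_eq_of_ne hy]
      have h5 : ∑ x ∈ Yᶜ, K y x * w x = 0 := by
        apply Finset.sum_eq_zero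
        intro x hx
        exact (hcoup y y.2 x (by simpa using hx)).resolve_left (fun h => hy (Subtype.ext h.1))
      rw [h5] at h2
      linarith
  have h6 : wY = A⁻¹ *ᵥ Pi.single ⟨u, hu⟩ (- K u v * w v) := by
    rw [← h1, mulVec_mulVec, nonsing_inv_mul _ hAu, one_mulVec]
  have h7 := congrFun h6 ⟨u, hu⟩
  rw [mulVec_single] at h7
  simp only [wY, Pi.smul_apply, col_apply, MulOpposite.smul_eq_mul_unop, MulOpposite.unop_op] at h7
  rw [h7]; ring

end Matrix

namespace OrderedDAG

variable {p : ℕ} {G : OrderedDAG p}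

/-! ### The concentration matrix of a directed tree -/

lemma adjacencyMatrix_apply_eq_zero (a : G.Edge → ℝ) {i j : Fin p} (h : ¬ G.Adj i j) :
    G.adjacencyMatrix a i j = 0 := by
  simp [adjacencyMatrix, h]

lemma adjacencyMatrix_apply_edge (a : G.Edge → ℝ) (e : G.Edge) :
    G.adjacencyMatrix a e.1.1 e.1.2 = a e := by
  simp [adjacencyMatrix, e.2]

lemma continuous_concentration : Continuous G.concentration := by
  have h : Continuous G.adjacencyMatrix := by
    refine continuous_matrix fun i j => ?_
    by_cases hij : G.Adj i j
    · simpa [adjacencyMatrix, hij] using continuous_apply _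
    · simpa [adjacencyMatrix, hij] using continuous_const
  exact (h.sub continuous_const).matrix_mul (h.sub continuous_const).matrix_transpose

lemma concentration_posDef (a : G.Edge → ℝ) : (G.concentration a).PosDef := by
  have hdet : (G.adjacencyMatrix a - 1).det = (-1) ^ p := by
    rw [Matrix.det_of_isUpperTriangular]
    · have (i : Fin p) : ¬ G.Adj i i := fun h => lt_irrefl i (G.lt_of_adj i i h)
      simp [adjacencyMatrix_apply_eq_zero, this]
    · intro i j hij
      have hij' : j < i := hij
      have : ¬ G.Adj i j := fun h => lt_asymm hij' (G.lt_of_adj i j h)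
      simp [adjacencyMatrix_apply_eq_zero a this, Matrix.one_apply_ne hij'.ne']
  have h := Matrix.PosDef.mul_conjTranspose_self (G.adjacencyMatrix a - 1) (by
    rw [Matrix.vecMul_injective_iff_isUnit, Matrix.isUnit_iff_isUnit_det, hdet]
    exact (isUnit_one.neg).pow p)
  rwa [Matrix.conjTranspose_eq_transpose_of_trivial] at h

/-- In the absence of colliders, no two parents are married: the concentration matrix is
supported on the skeleton. -/
lemma IsDirectedTree.concentration_apply_of_ne (hG : G.IsDirectedTree) (a : G.Edge → ℝ)
    {i j : Fin p} (hij : i ≠ j) :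
    G.concentration a i j = - G.adjacencyMatrix a i j - G.adjacencyMatrix a j i := by
  have h : ∀ k, G.adjacencyMatrix a i k * G.adjacencyMatrix a j k = 0 := by
    intro k
    by_cases hi : G.Adj i k
    · by_cases hj : G.Adj j k
      · exact absurd (hG.2 i j k hi hj) hij
      · rw [adjacencyMatrix_apply_eq_zero a hj, mul_zero]
    · rw [adjacencyMatrix_apply_eq_zero a hi, zero_mul]
  rw [concentration, Matrix.mul_apply]
  simp only [Matrix.transpose_apply, Matrix.sub_apply, sub_mul, mul_sub, h, Matrix.one_apply,
    Finset.sum_sub_distrib, ite_mul, mul_ite, mul_one, mul_zero, one_mul, zero_mul]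
  simp only [Finset.sum_ite_eq, Finset.mem_univ, if_true, Finset.sum_const_zero, if_neg hij]
  ring

lemma IsDirectedTree.adj_of_concentration_ne_zero (hG : G.IsDirectedTree) (a : G.Edge → ℝ)
    {i j : Fin p} (hij : i ≠ j) (h : G.concentration a i j ≠ 0) : G.skeleton.Adj i j := by
  by_contra hn
  have hn' : ¬ (G.Adj i j ∨ G.Adj j i) := hn
  rw [not_or] at hn'
  rw [hG.concentration_apply_of_ne a hij, adjacencyMatrix_apply_eq_zero a hn'.1,
    adjacencyMatrix_apply_eq_zero a hn'.2] at h
  simp at h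

/-! ### Edges along a walk -/

open Classical in
/-- The directed edges underlying the edges of a walk in the skeleton. -/
noncomputable def walkEdges {i j : Fin p} (w : G.skeleton.Walk i j) : Finset G.Edge :=
  Finset.univ.filter fun e => s(e.1.1, e.1.2) ∈ w.edges

lemma mem_walkEdges {i j : Fin p} {w : G.skeleton.Walk i j} {e : G.Edge} :
    e ∈ walkEdges w ↔ s(e.1.1, e.1.2) ∈ w.edges := by
  simp [walkEdges]

lemma edge_sym2_injective : Function.Injective fun e : G.Edge => s(e.1.1, e.1.2) := by
  rintro ⟨⟨a, b⟩, h⟩ ⟨⟨c, d⟩, h'⟩ he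
  simp only [Sym2.eq_iff] at he
  have h1 := G.lt_of_adj _ _ h
  have h2 := G.lt_of_adj _ _ h'
  rcases he with ⟨rfl, rfl⟩ | ⟨rfl, rfl⟩
  · rfl
  · exact absurd h1 (lt_asymm h2)

lemma exists_edge_of_skeleton_adj {i j : Fin p} (h : G.skeleton.Adj i j) :
    ∃ e : G.Edge, s(e.1.1, e.1.2) = s(i, j) := by
  have h' : G.Adj i j ∨ G.Adj j i := h
  rcases h' with h' | h'
  · exact ⟨⟨(i, j), h'⟩, rfl⟩
  · exact ⟨⟨(j, i), h'⟩, Sym2.eq_swap⟩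

lemma IsDirectedTree.abs_concentration_eq (hG : G.IsDirectedTree) (a : G.Edge → ℝ)
    {i j : Fin p} {e : G.Edge} (he : s(e.1.1, e.1.2) = s(i, j)) :
    |G.concentration a i j| = |a e| := by
  have hlt := G.lt_of_adj _ _ e.2
  have hn : ¬ G.Adj e.1.2 e.1.1 := fun h => lt_asymm hlt (G.lt_of_adj _ _ h)
  have h0 := adjacencyMatrix_apply_eq_zero a hn
  have h1 := adjacencyMatrix_apply_edge a e
  rw [Sym2.eq_iff] at he
  rcases he with ⟨h2, h3⟩ | ⟨h2, h3⟩
  · rw [← h2, ← h3, hG.concentration_apply_of_ne a hlt.ne, h0, h1, sub_zero, abs_neg]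
  · rw [← h2, ← h3, hG.concentration_apply_of_ne a hlt.ne', h0, h1, neg_zero, zero_sub, abs_neg]

lemma card_walkEdges {i j : Fin p} {w : G.skeleton.Walk i j} (hw : w.IsPath) :
    (walkEdges w).card = w.length := by
  classical
  rw [← w.length_edges, ← List.toFinset_card_of_nodup hw.isTrail.edges_nodup,
    ← Finset.card_image_of_injective (walkEdges w) edge_sym2_injective]
  congr 1
  ext e
  simp only [Finset.mem_image, mem_walkEdges, List.mem_toFinset]
  constructor
  · rintro ⟨e, he, rfl⟩
    exact he
  · intro he
    induction e with
    | h u v =>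
      obtain ⟨e', he'⟩ := exists_edge_of_skeleton_adj (w.adj_of_mem_edges he)
      exact ⟨e', he' ▸ he, he'⟩

lemma prod_walkEdges_cons (a : G.Edge → ℝ) {u v j : Fin p} (h : G.skeleton.Adj u v)
    (q : G.skeleton.Walk v j) (hu : u ∉ q.support) {e : G.Edge} (he : s(e.1.1, e.1.2) = s(u, v)) :
    ∏ x ∈ walkEdges (SimpleGraph.Walk.cons h q), a x = a e * ∏ x ∈ walkEdges q, a x := by
  classical
  have h1 : walkEdges (SimpleGraph.Walk.cons h q) = insert e (walkEdges q) := by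
    ext x
    simp only [mem_walkEdges, SimpleGraph.Walk.edges_cons, List.mem_cons, Finset.mem_insert]
    rw [← he]
    exact or_congr_left edge_sym2_injective.eq_iff
  have h2 : e ∉ walkEdges q := by
    rw [mem_walkEdges, he]
    exact fun hm => hu (q.fst_mem_support_of_mem_edges hm)
  rw [h1, Finset.prod_insert h2]

/-! ### Propagation of the linear system along a path -/

open Classical in
/-- The vertices of `R` that are still connected to `u` when the edge between `u` and `v` is
deleted from the skeleton. -/
noncomputable def side (G : OrderedDAG p) (R : Finset (Fin p)) (u v : Fin p) : Finset (Fin p) :=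
  R.filter fun x => (G.skeleton.deleteEdges {s(u, v)}).Reachable u x

open Classical in
/-- The variance of `u` given everything outside `G.side R u v` (and `0` if `u ∉ R`). -/
noncomputable def sideVariance (G : OrderedDAG p) (R : Finset (Fin p)) (u v : Fin p)
    (a : G.Edge → ℝ) : ℝ :=
  if hu : u ∈ G.side R u v then
    ((G.concentration a).submatrix (fun r : G.side R u v => (r : Fin p))
      (fun r : G.side R u v => (r : Fin p)))⁻¹ ⟨u, hu⟩ ⟨u, hu⟩
  else 0

lemma self_mem_side {R : Finset (Fin p)} {u : Fin p} (v : Fin p) (hu : u ∈ R) :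
    u ∈ G.side R u v := by
  simp only [side, Finset.mem_filter]
  exact ⟨hu, SimpleGraph.Reachable.refl u⟩

lemma sideVariance_pos {R : Finset (Fin p)} {u : Fin p} (v : Fin p) (hu : u ∈ R)
    (a : G.Edge → ℝ) : 0 < G.sideVariance R u v a := by
  classical
  rw [sideVariance, dif_pos (self_mem_side v hu)]
  exact (((concentration_posDef a).submatrix Subtype.val_injective).inv).diag_pos

lemma continuous_sideVariance (R : Finset (Fin p)) (u v : Fin p) :
    Continuous (G.sideVariance R u v) := by
  classical
  unfold sideVariance
  by_cases hu : u ∈ G.side R u v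
  · simp only [dif_pos hu, Matrix.inv_def, Matrix.smul_apply, Ring.inverse_eq_inv', smul_eq_mul]
    have hc := (continuous_concentration (G := G)).matrix_submatrix
      (fun r : G.side R u v => (r : Fin p)) (fun r : G.side R u v => (r : Fin p))
    refine (hc.matrix_det.inv₀ fun a => ?_).mul (hc.matrix_adjugate.matrix_elem _ _)
    exact ((concentration_posDef a).submatrix Subtype.val_injective).det_pos.ne'
  · simp only [dif_neg hu]
    exact continuous_const

/-- The linear system attached to a bordered minor propagates along the edges of a tree: if `j`
lies behind `v` as seen from `u ∈ R`, the unknown at `u` is determined by the unknown at `v`. -/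
lemma IsDirectedTree.eq_neg_mul_of_adj (hG : G.IsDirectedTree) (a : G.Edge → ℝ)
    {R : Finset (Fin p)} {u v j : Fin p} (huv : G.skeleton.Adj u v) (hu : u ∈ R)
    (hj : (G.skeleton.deleteEdges {s(u, v)}).Reachable v j) {w : Fin p → ℝ}
    (hw0 : ∀ x ∉ R, x ≠ j → w x = 0) (hKw : ∀ r ∈ R, (G.concentration a).mulVec w r = 0) :
    w u = - G.concentration a u v * G.sideVariance R u v a * w v := by
  classical
  have hbr : ¬ (G.skeleton.deleteEdges {s(u, v)}).Reachable u v :=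
    SimpleGraph.isBridge_iff.mp
      (SimpleGraph.isAcyclic_iff_forall_adj_isBridge.mp hG.1.isAcyclic huv)
  have huY : u ∈ G.side R u v := self_mem_side v hu
  have hvY : v ∉ G.side R u v := by simp [side, hbr]
  rw [sideVariance, dif_pos huY]
  refine (concentration_posDef a).eq_neg_mul_of_mulVec_eq_zero _ huY hvY w
    (fun y hy => hKw y (Finset.mem_of_mem_filter y hy)) fun y hy x hx => ?_
  by_contra hcon
  rw [not_or, ← Ne, mul_ne_zero_iff] at hcon
  obtain ⟨hne, hKyx, hwx⟩ := hcon
  have hyx : y ≠ x := fun h => hx (h ▸ hy)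
  have hadj := hG.adj_of_concentration_ne_zero a hyx hKyx
  have hyr : (G.skeleton.deleteEdges {s(u, v)}).Reachable u y := (Finset.mem_filter.mp hy).2
  have hsym : s(y, x) ≠ s(u, v) := by
    rw [Ne, Sym2.eq_iff, not_or]
    exact ⟨hne, fun h => hvY (h.1 ▸ hy)⟩
  have hxr : (G.skeleton.deleteEdges {s(u, v)}).Reachable u x :=
    hyr.trans (SimpleGraph.Adj.reachable (by simp [SimpleGraph.deleteEdges_adj, hadj, hsym]))
  have hxR : x ∉ R := fun h => hx (Finset.mem_filter.mpr ⟨h, hxr⟩)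
  have hxj : x = j := by
    by_contra h
    exact hwx (hw0 x hxR h)
  exact hbr (hxr.trans (hxj ▸ hj.symm))

lemma reachable_deleteEdges_of_notMem_edges {e : Sym2 (Fin p)} {v j : Fin p}
    (q : G.skeleton.Walk v j) (he : e ∉ q.edges) :
    (G.skeleton.deleteEdges {e}).Reachable v j :=
  ⟨q.toDeleteEdges {e} fun x hx => by
    rw [Set.mem_singleton_iff]
    rintro rfl
    exact he hx⟩

/-- Along a path inside `R ∪ {j}`, the unknown at the first vertex is, up to sign and up to a
positive factor depending continuously on the parameters, the product of the edge weights. -/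
lemma IsDirectedTree.exists_abs_eq_prod (hG : G.IsDirectedTree) (R : Finset (Fin p))
    {v j : Fin p} (q : G.skeleton.Walk v j) (hq : q.IsPath)
    (hR : ∀ x ∈ q.support, x ≠ j → x ∈ R) :
    ∃ g : (G.Edge → ℝ) → ℝ, Continuous g ∧ (∀ a, 0 < g a) ∧ ∀ a (w : Fin p → ℝ), w j = 1 →
      (∀ x ∉ R, x ≠ j → w x = 0) → (∀ r ∈ R, (G.concentration a).mulVec w r = 0) →
      |w v| = |∏ e ∈ walkEdges q, a e| * g a := by
  induction q with
  | nil =>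
    refine ⟨fun _ => 1, continuous_const, fun _ => one_pos, fun a w hwj _ _ => ?_⟩
    simp [hwj, walkEdges]
  | @cons u v j h q ih =>
    rw [SimpleGraph.Walk.cons_isPath_iff] at hq
    obtain ⟨g, hgc, hgp, hg⟩ := ih hq.1 fun x hx => hR x (by simp [hx])
    have hu : u ∈ R := hR u (by simp) fun h => hq.2 (h ▸ q.end_mem_support)
    obtain ⟨e, he⟩ := exists_edge_of_skeleton_adj h
    refine ⟨fun a => G.sideVariance R u v a * g a, (continuous_sideVariance R u v).mul hgc,
      fun a => mul_pos (sideVariance_pos v hu a) (hgp a), fun a w hwj hw0 hKw => ?_⟩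
    have hj := reachable_deleteEdges_of_notMem_edges (e := s(u, v)) q
      fun hm => hq.2 (q.fst_mem_support_of_mem_edges hm)
    rw [hG.eq_neg_mul_of_adj a h hu hj hw0 hKw, prod_walkEdges_cons a h q hq.2 he, abs_mul, abs_mul,
      abs_mul, abs_neg, hg a w hwj hw0 hKw, hG.abs_concentration_eq a he,
      abs_of_pos (sideVariance_pos v hu a)]
    ring

/-- A path that leaves `R ∪ {j}` forces the unknown at its first vertex to vanish. -/
lemma IsDirectedTree.eq_zero_of_notMem (hG : G.IsDirectedTree) {R : Finset (Fin p)}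
    {v j : Fin p} (q : G.skeleton.Walk v j) (hq : q.IsPath)
    (hR : ∃ x ∈ q.support, x ≠ j ∧ x ∉ R) (a : G.Edge → ℝ) {w : Fin p → ℝ}
    (hw0 : ∀ x ∉ R, x ≠ j → w x = 0) (hKw : ∀ r ∈ R, (G.concentration a).mulVec w r = 0) :
    w v = 0 := by
  induction q with
  | nil =>
    obtain ⟨x, hx, hxj, -⟩ := hR
    simp at hx
    exact absurd hx hxj
  | @cons u v j h q ih =>
    rw [SimpleGraph.Walk.cons_isPath_iff] at hq
    have huj : u ≠ j := fun h => hq.2 (h ▸ q.end_mem_support)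
    by_cases hu : u ∈ R
    · obtain ⟨x, hx, hxj, hxR⟩ := hR
      have hxq : x ∈ q.support := by
        rw [SimpleGraph.Walk.support_cons, List.mem_cons] at hx
        exact hx.resolve_left fun h => hxR (h ▸ hu)
      have hj := reachable_deleteEdges_of_notMem_edges (e := s(u, v)) q
        fun hm => hq.2 (q.fst_mem_support_of_mem_edges hm)
      rw [hG.eq_neg_mul_of_adj a h hu hj hw0 hKw, ih hq.1 ⟨x, hxq, hxj, hxR⟩ hw0, mul_zero]
    · exact hw0 u hu huj

/-- At the start `i ∉ R` of a path to `j`, only the neighbour of `i` on the path contributes. -/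
lemma IsDirectedTree.mulVec_start_eq (hG : G.IsDirectedTree) (a : G.Edge → ℝ)
    {R : Finset (Fin p)} {i v j : Fin p} (h : G.skeleton.Adj i v) (q : G.skeleton.Walk v j)
    (hq : (SimpleGraph.Walk.cons h q).IsPath) (hi : i ∉ R) {w : Fin p → ℝ}
    (hw0 : ∀ x ∉ R, x ≠ j → w x = 0) (hKw : ∀ r ∈ R, (G.concentration a).mulVec w r = 0) :
    (G.concentration a).mulVec w i = G.concentration a i v * w v := by
  rw [SimpleGraph.Walk.cons_isPath_iff] at hq
  have hwi : w i = 0 := hw0 i hi fun h => hq.2 (h ▸ q.end_mem_support)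
  have h1 : (G.concentration a).mulVec w i = ∑ x, G.concentration a i x * w x := rfl
  rw [h1]
  refine Finset.sum_eq_single v (fun x _ hxv => ?_) (by simp)
  by_contra hne
  rw [← Ne, mul_ne_zero_iff] at hne
  have hix : i ≠ x := fun h => hne.2 (h ▸ hwi)
  have hadj := hG.adj_of_concentration_ne_zero a hix hne.1
  have hbr : ¬ (G.skeleton.deleteEdges {s(x, i)}).Reachable x i :=
    SimpleGraph.isBridge_iff.mp
      (SimpleGraph.isAcyclic_iff_forall_adj_isBridge.mp hG.1.isAcyclic hadj.symm)
  have hj : (G.skeleton.deleteEdges {s(x, i)}).Reachable i j := by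
    apply reachable_deleteEdges_of_notMem_edges (SimpleGraph.Walk.cons h q)
    rw [SimpleGraph.Walk.edges_cons, List.mem_cons, not_or]
    refine ⟨?_, fun hm => hq.2 (q.snd_mem_support_of_mem_edges hm)⟩
    rw [Sym2.eq_swap, Sym2.congr_right]
    exact hxv
  by_cases hxR : x ∈ R
  · apply hne.2
    rw [hG.eq_neg_mul_of_adj a hadj.symm hxR hj hw0 hKw, hwi, mul_zero]
  · have hxj : x = j := by
      by_contra hxj
      exact hne.2 (hw0 x hxR hxj)
    exact hbr (hxj ▸ hj.symm)

lemma bordMinor_self_pos (a : G.Edge → ℝ) {i : Fin p} {R : Finset (Fin p)} (hi : i ∉ R) :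
    0 < bordMinor (G.concentration a) i i R := by
  refine ((concentration_posDef a).submatrix ?_).det_pos
  rintro (_ | x) (_ | y) hxy
  · rfl
  · exact absurd (show (y : Fin p) ∈ R from y.2) (by simpa [← show i = y from hxy] using hi)
  · exact absurd (show (x : Fin p) ∈ R from x.2) (by simpa [show (x : Fin p) = i from hxy] using hi)
  · exact congrArg some (Subtype.ext hxy)

lemma continuous_bordMinor (i j : Fin p) (R : Finset (Fin p)) :
    Continuous fun a : G.Edge → ℝ => bordMinor (G.concentration a) i j R :=
  (continuous_concentration.matrix_submatrix _ _).matrix_det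

/-! ### Partial correlations in a directed tree -/

/-- The partial correlation of the endpoints of a path that avoids `S` is, up to sign and up to a
positive continuous factor, the product of the edge weights along the path. -/
lemma IsDirectedTree.exists_abs_partialCorr_eq (hG : G.IsDirectedTree) {i j : Fin p}
    {S : Finset (Fin p)} (hij : i ≠ j) (q : G.skeleton.Walk i j) (hq : q.IsPath)
    (hS : ∀ x ∈ q.support, x ∉ S) :
    ∃ g : (G.Edge → ℝ) → ℝ, Continuous g ∧ (∀ a, 0 < g a) ∧
      ∀ a, |G.partialCorr a i j S| = |∏ e ∈ walkEdges q, a e| * g a := by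
  cases q with
  | nil => exact absurd rfl hij
  | @cons _ v _ h q =>
    set R : Finset (Fin p) := (insert i (insert j S))ᶜ with hRdef
    have hiR : i ∉ R := by simp [hRdef]
    have hjR : j ∉ R := by simp [hRdef]
    have hq' := (SimpleGraph.Walk.cons_isPath_iff h q).mp hq
    obtain ⟨g, hgc, hgp, hg⟩ := hG.exists_abs_eq_prod R q hq'.1 fun x hx hxj => by
      simp only [hRdef, Finset.mem_compl, Finset.mem_insert, not_or]
      exact ⟨fun h => hq'.2 (h ▸ hx), hxj, hS x (by simp [hx])⟩
    obtain ⟨e, he⟩ := exists_edge_of_skeleton_adj h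
    let d : (G.Edge → ℝ) → ℝ := fun a => ((G.concentration a).submatrix
      (fun r : R => (r : Fin p)) (fun r : R => (r : Fin p))).det
    have hdp : ∀ a, 0 < d a := fun a =>
      ((concentration_posDef a).submatrix Subtype.val_injective).det_pos
    let n : (G.Edge → ℝ) → ℝ := fun a =>
      √(bordMinor (G.concentration a) i i R * bordMinor (G.concentration a) j j R)
    have hnp : ∀ a, 0 < n a := fun a =>
      Real.sqrt_pos.mpr (mul_pos (bordMinor_self_pos a hiR) (bordMinor_self_pos a hjR))
    refine ⟨fun a => d a * g a / n a, ?_, fun a => div_pos (mul_pos (hdp a) (hgp a)) (hnp a),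
      fun a => ?_⟩
    · refine Continuous.div ?_ ?_ fun a => (hnp a).ne'
      · exact (continuous_concentration.matrix_submatrix _ _).matrix_det.mul hgc
      · exact ((continuous_bordMinor i i R).mul (continuous_bordMinor j j R)).sqrt
    · obtain ⟨w, hwj, hw0, hKw, hb⟩ := (concentration_posDef a).exists_bordMinor_eq i j R hjR
      have h1 : G.partialCorr a i j S = d a * (G.concentration a i v * w v) / n a := by
        rw [← hG.mulVec_start_eq a h q hq hiR hw0 hKw, ← hb]
        rfl
      rw [h1, abs_div, abs_mul, abs_mul, abs_of_pos (hdp a), abs_of_pos (hnp a),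
        hg a w hwj hw0 hKw, hG.abs_concentration_eq a he, prod_walkEdges_cons a h q hq'.2 he,
        abs_mul]
      ring

lemma IsDirectedTree.partialCorr_eq_zero (hG : G.IsDirectedTree) {i j : Fin p}
    {S : Finset (Fin p)} (hij : i ≠ j) (hi : i ∉ S) (hj : j ∉ S) (q : G.skeleton.Walk i j)
    (hq : q.IsPath) (hS : ∃ x ∈ q.support, x ∈ S) (a : G.Edge → ℝ) :
    G.partialCorr a i j S = 0 := by
  cases q with
  | nil => exact absurd rfl hij
  | @cons _ v _ h q =>
    set R : Finset (Fin p) := (insert i (insert j S))ᶜ with hRdef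
    have hiR : i ∉ R := by simp [hRdef]
    have hjR : j ∉ R := by simp [hRdef]
    have hq' := (SimpleGraph.Walk.cons_isPath_iff h q).mp hq
    obtain ⟨w, hwj, hw0, hKw, hb⟩ := (concentration_posDef a).exists_bordMinor_eq i j R hjR
    have h1 : bordMinor (G.concentration a) i j R = 0 := by
      rw [hb, hG.mulVec_start_eq a h q hq hiR hw0 hKw, hG.eq_zero_of_notMem q hq'.1 ?_ a hw0 hKw,
        mul_zero, mul_zero]
      obtain ⟨x, hx, hxS⟩ := hS
      rw [SimpleGraph.Walk.support_cons, List.mem_cons] at hx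
      exact ⟨x, hx.resolve_left fun h => hi (h ▸ hxS), fun h => hj (h ▸ hxS), by simp [hRdef, hxS]⟩
    rw [partialCorr, ← hRdef, h1, zero_div]

/-- Without colliders in the graph, a path d-connects its endpoints if and only if it avoids the
conditioning set. -/
lemma IsDirectedTree.dConnects_iff (hG : G.IsDirectedTree) {i j : Fin p}
    (q : G.skeleton.Walk i j) (S : Finset (Fin p)) :
    G.DConnects q S ↔ q.IsPath ∧ ∀ x ∈ q.support, x ∉ S := by
  unfold DConnects
  refine and_congr_right fun hq => ?_
  have hcol : ∀ k, ¬ G.IsColliderOn q k := by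
    rintro k ⟨hk0, hk, h1, h2⟩
    have := hq.getVert_injOn (by simp; omega) (by simp; omega) (hG.2 _ _ _ h1 h2)
    omega
  simp only [hcol, not_false_eq_true, true_imp_iff, false_imp_iff, and_true]
  constructor
  · intro h x hx
    obtain ⟨k, rfl, hk⟩ := SimpleGraph.Walk.mem_support_iff_exists_getVert.mp hx
    exact h k hk
  · exact fun h k _ => h _ (q.getVert_mem_support k)

/-- A parameter fails to be strong-faithful precisely when some d-connected pair has a small
partial correlation: d-separated pairs have partial correlation zero. -/
lemma IsDirectedTree.not_strongFaithful_iff (hG : G.IsDirectedTree) {t : ℝ} (ht : 0 ≤ t)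
    (a : G.Edge → ℝ) :
    ¬ G.StrongFaithful t a ↔ ∃ (S : Finset (Fin p)) (i j : Fin p), i ≠ j ∧
      (∃ q : G.skeleton.Walk i j, q.IsPath ∧ ∀ x ∈ q.support, x ∉ S) ∧
      |G.partialCorr a i j S| ≤ t := by
  unfold StrongFaithful DSeparated
  simp only [hG.dConnects_iff]
  push Not
  constructor
  · rintro ⟨S, i, j, hij, hi, hj, ⟨h1, q, h2⟩ | ⟨h1, h2⟩⟩
    · exact ⟨S, i, j, hij, ⟨q, h2⟩, h1⟩
    · obtain ⟨q, hq⟩ := hG.1.connected.exists_isPath i j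
      rw [hG.partialCorr_eq_zero hij hi hj q hq (h2 q hq) a, abs_zero] at h1
      exact absurd ht (not_le.mpr h1)
  · rintro ⟨S, i, j, hij, ⟨q, hq, hS⟩, h1⟩
    exact ⟨S, i, j, hij, hS i q.start_mem_support, hS j q.end_mem_support, Or.inl ⟨h1, q, hq, hS⟩⟩

end OrderedDAG

/-! ### Auxiliary integrals on the line -/

lemma MeasureTheory.integrable_comp_abs_of_integrableOn_Ioi {f : ℝ → ℝ}
    (hf : IntegrableOn f (Set.Ioi 0)) : Integrable fun x => f |x| := by
  have h1 : IntegrableOn (fun x => f |x|) (Set.Ioi 0) :=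
    hf.congr_fun (fun x hx => by rw [abs_of_pos hx]) measurableSet_Ioi
  have h2 : IntegrableOn (fun x ↦ f |x|) (Set.Iic 0) := by
    rw [← Measure.map_neg_eq_self (volume : Measure ℝ)]
    let m : MeasurableEmbedding fun x : ℝ => -x := (Homeomorph.neg ℝ).measurableEmbedding
    rw [m.integrableOn_map_iff]
    simp_rw [Function.comp_def, abs_neg, Set.neg_preimage, Set.neg_Iic, neg_zero]
    exact Iff.mpr integrableOn_Ici_iff_integrableOn_Ioi h1
  rw [← integrableOn_univ, ← Set.Iic_union_Ioi (a := (0 : ℝ))]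
  exact h2.union h1

lemma integrable_exp_neg_half_abs : Integrable fun x : ℝ => Real.exp (-(|x| / 2)) := by
  refine integrable_comp_abs_of_integrableOn_Ioi (f := fun x => Real.exp (-(x / 2))) ?_
  refine (exp_neg_integrableOn_Ioi 0 (b := 1 / 2) (by norm_num)).congr_fun (fun x _ => ?_)
    measurableSet_Ioi
  simp only
  congr 1
  ring

lemma integrable_inv_sqrt_abs (c : ℝ) :
    Integrable fun x : ℝ => if |x| ≤ c then (√|x|)⁻¹ else 0 := by
  refine integrable_comp_abs_of_integrableOn_Ioi (f := fun x => if x ≤ c then (√x)⁻¹ else 0) ?_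
  rcases le_or_gt c 0 with hc | hc
  · refine IntegrableOn.congr_fun (f := fun _ => 0) integrableOn_zero (fun x hx => ?_)
      measurableSet_Ioi
    have hx' : ¬ x ≤ c := not_le.mpr (hc.trans_lt hx)
    simp [hx']
  · have h1 : IntegrableOn (fun x : ℝ => x ^ (-(1 / 2) : ℝ)) (Set.Ioc 0 c) :=
      (intervalIntegrable_iff_integrableOn_Ioc_of_le hc.le).mp
        (intervalIntegral.intervalIntegrable_rpow' (by norm_num))
    rw [← integrable_indicator_iff measurableSet_Ioc] at h1
    rw [← integrable_indicator_iff measurableSet_Ioi]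
    refine h1.congr (ae_of_all _ fun x => ?_)
    by_cases hx : 0 < x <;> by_cases hxc : x ≤ c
    · simp [Set.indicator, hx, hxc, Real.sqrt_eq_rpow, Real.rpow_neg hx.le]
    · simp [Set.indicator, hx, hxc]
    · simp [Set.indicator, hx]
    · simp [Set.indicator, hx]

/-! ### Coordinates adapted to a monomial -/

/-- The map `t ↦ sgn(t) exp(-L |t|)`, a bijection from the nonzero reals onto the nonzero reals in
`(-1, 1)`. -/
noncomputable def signExp (L t : ℝ) : ℝ := if 0 < t then Real.exp (-(L * t)) else -Real.exp (L * t)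

lemma abs_signExp (L t : ℝ) : |signExp L t| = Real.exp (-(L * |t|)) := by
  unfold signExp
  split_ifs with h
  · rw [abs_of_pos h, abs_of_pos (Real.exp_pos _)]
  · rw [abs_neg, abs_of_nonpos (not_lt.mp h), abs_of_pos (Real.exp_pos _)]
    congr 1
    ring

lemma measurable_signExp (L : ℝ) : Measurable (signExp L) := by
  unfold signExp
  exact Measurable.ite measurableSet_Ioi (by fun_prop) (by fun_prop)

lemma signExp_injective {L : ℝ} (hL : 0 < L) : Function.Injective (signExp L) := by
  intro s t h
  unfold signExp at h
  split_ifs at h with hs ht ht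
  · have := Real.exp_injective h
    nlinarith
  · have h1 := Real.exp_pos (-(L * s))
    have h2 := Real.exp_pos (L * t)
    linarith
  · have h1 := Real.exp_pos (L * s)
    have h2 := Real.exp_pos (-(L * t))
    linarith
  · have := Real.exp_injective (neg_injective h)
    exact mul_left_cancel₀ hL.ne' this

lemma exists_signExp_eq {L : ℝ} (hL : 0 < L) {x : ℝ} (hx0 : x ≠ 0) (hx1 : |x| < 1) :
    ∃ t ≠ 0, signExp L t = x := by
  have hlog : Real.log |x| < 0 := Real.log_neg (abs_pos.mpr hx0) hx1
  rcases lt_or_gt_of_ne hx0 with h | h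
  · have ht : Real.log |x| / L < 0 := div_neg_of_neg_of_pos hlog hL
    refine ⟨Real.log |x| / L, ht.ne, ?_⟩
    rw [signExp, if_neg ht.not_gt, mul_div_cancel₀ _ hL.ne', Real.exp_log (abs_pos.mpr hx0),
      abs_of_neg h, neg_neg]
  · have ht : 0 < -(Real.log |x| / L) := neg_pos.mpr (div_neg_of_neg_of_pos hlog hL)
    refine ⟨-(Real.log |x| / L), ht.ne', ?_⟩
    rw [signExp, if_pos ht, mul_neg, neg_neg, mul_div_cancel₀ _ hL.ne',
      Real.exp_log (abs_pos.mpr hx0), abs_of_pos h]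

lemma hasDerivAt_signExp (L : ℝ) {t : ℝ} (ht : t ≠ 0) :
    HasDerivAt (signExp L) (-(L * Real.exp (-(L * |t|)))) t := by
  rcases lt_or_gt_of_ne ht with h | h
  · have h1 : HasDerivAt (fun t => -Real.exp (L * t)) (-(Real.exp (L * t) * (L * 1))) t :=
      (((hasDerivAt_id t).const_mul L).exp).neg
    refine (h1.congr_of_eventuallyEq ?_).congr_deriv ?_
    · filter_upwards [Iio_mem_nhds h] with s hs
      rw [signExp, if_neg (not_lt.mpr (le_of_lt hs))]
    · rw [abs_of_neg h, mul_neg, neg_neg]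
      ring
  · have h1 : HasDerivAt (fun t => Real.exp (-(L * t))) (Real.exp (-(L * t)) * (-(L * 1))) t :=
      (((hasDerivAt_id t).const_mul L).neg).exp
    refine (h1.congr_of_eventuallyEq ?_).congr_deriv ?_
    · filter_upwards [Ioi_mem_nhds h] with s hs
      rw [signExp, if_pos (show 0 < s from hs)]
    · rw [abs_of_pos h]
      ring

section Pi

variable {E : Type*} [DecidableEq E]

/-- The total exponent `∑ |u_i|` carried by the coordinates in `T` other than `e₀`. -/
noncomputable def offSum (T : Finset E) (e₀ : E) (u : E → ℝ) : ℝ := ∑ i ∈ T.erase e₀, |u i|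

/-- Coordinates adapted to the monomial `∏ e ∈ T, x e` at scale `r = exp (-L)`: up to signs,
`x e = r ^ |u e|` for `e ∈ T`, `e ≠ e₀`, while `x e₀` is chosen such that `|∏ e ∈ T, x e|` equals
`r * |u e₀|`; the coordinates outside `T` are left alone. -/
noncomputable def monomialChart (T : Finset E) (e₀ : E) (L : ℝ) (u : E → ℝ) : E → ℝ := fun e =>
  if e = e₀ then Real.exp (-(L * (1 - offSum T e₀ u))) * u e
  else if e ∈ T then signExp L (u e) else u e

lemma monomialChart_base (T : Finset E) (e₀ : E) (L : ℝ) (u : E → ℝ) :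
    monomialChart T e₀ L u e₀ = Real.exp (-(L * (1 - offSum T e₀ u))) * u e₀ := by
  simp [monomialChart]

lemma monomialChart_of_mem {T : Finset E} {e₀ e : E} (h : e ∈ T) (he : e ≠ e₀) (L : ℝ)
    (u : E → ℝ) : monomialChart T e₀ L u e = signExp L (u e) := by
  simp [monomialChart, h, he]

lemma monomialChart_of_notMem {T : Finset E} {e₀ e : E} (h₀ : e₀ ∈ T) (h : e ∉ T) (L : ℝ)
    (u : E → ℝ) : monomialChart T e₀ L u e = u e := by
  have he : e ≠ e₀ := fun h' => h (h' ▸ h₀)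
  simp [monomialChart, h, he]

lemma measurable_offSum (T : Finset E) (e₀ : E) : Measurable (offSum T e₀) := by
  unfold offSum
  fun_prop

lemma continuous_offSum (T : Finset E) (e₀ : E) : Continuous (offSum T e₀) := by
  unfold offSum
  fun_prop

lemma measurable_monomialChart (T : Finset E) (e₀ : E) (L : ℝ) :
    Measurable (monomialChart T e₀ L) := by
  refine measurable_pi_lambda _ fun e => ?_
  unfold monomialChart
  have := measurable_offSum T e₀
  split_ifs
  · fun_prop
  · exact (measurable_signExp L).comp (measurable_pi_apply e)
  · fun_prop

lemma prod_abs_monomialChart {T : Finset E} {e₀ : E} (h₀ : e₀ ∈ T) (L : ℝ) (u : E → ℝ) :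
    ∏ e ∈ T, |monomialChart T e₀ L u e| = Real.exp (-L) * |u e₀| := by
  rw [← Finset.mul_prod_erase T _ h₀]
  have h1 : ∏ e ∈ T.erase e₀, |monomialChart T e₀ L u e| = Real.exp (-(L * offSum T e₀ u)) := by
    rw [offSum, Finset.mul_sum, ← Finset.sum_neg_distrib, Real.exp_sum]
    refine Finset.prod_congr rfl fun e he => ?_
    rw [monomialChart_of_mem (Finset.mem_of_mem_erase he) (Finset.ne_of_mem_erase he), abs_signExp]
  rw [h1, monomialChart_base, abs_mul, abs_of_pos (Real.exp_pos _), mul_right_comm, ← Real.exp_add]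
  congr 2
  ring

lemma monomialChart_injective {T : Finset E} {e₀ : E} (h₀ : e₀ ∈ T) {L : ℝ} (hL : 0 < L) :
    Function.Injective (monomialChart T e₀ L) := by
  intro u v h
  have h1 : ∀ e, e ≠ e₀ → u e = v e := by
    intro e he
    have h2 := congrFun h e
    by_cases heT : e ∈ T
    · rw [monomialChart_of_mem heT he, monomialChart_of_mem heT he] at h2
      exact signExp_injective hL h2
    · rwa [monomialChart_of_notMem h₀ heT, monomialChart_of_notMem h₀ heT] at h2
  have h3 : offSum T e₀ u = offSum T e₀ v :=
    Finset.sum_congr rfl fun i hi => by rw [h1 i (Finset.ne_of_mem_erase hi)]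
  funext e
  by_cases he : e = e₀
  · subst he
    have h2 := congrFun h e
    rw [monomialChart_base, monomialChart_base, h3] at h2
    exact mul_left_cancel₀ (Real.exp_pos _).ne' h2
  · exact h1 e he

lemma exists_monomialChart_eq {T : Finset E} {e₀ : E} (h₀ : e₀ ∈ T) {L : ℝ} (hL : 0 < L)
    {x : E → ℝ} (hx0 : ∀ e ∈ T, x e ≠ 0) (hx1 : ∀ e ∈ T, |x e| < 1) :
    ∃ u, (∀ e ∈ T, u e ≠ 0) ∧ monomialChart T e₀ L u = x := by
  have h1 : ∀ e, ∃ t : ℝ, (e ∈ T → t ≠ 0 ∧ signExp L t = x e) ∧ (e ∉ T → t = x e) := by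
    intro e
    by_cases he : e ∈ T
    · obtain ⟨t, ht⟩ := exists_signExp_eq hL (hx0 e he) (hx1 e he)
      exact ⟨t, fun _ => ht, fun h => absurd he h⟩
    · exact ⟨x e, fun h => absurd h he, fun _ => rfl⟩
  choose t ht ht' using h1
  let s : ℝ := Real.exp (L * (1 - offSum T e₀ t)) * x e₀
  let u : E → ℝ := Function.update t e₀ s
  have hu : ∀ e, e ≠ e₀ → u e = t e := fun e he => Function.update_of_ne he _ _
  have hu0 : u e₀ = s := Function.update_self _ _ _
  have hoff : offSum T e₀ u = offSum T e₀ t :=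
    Finset.sum_congr rfl fun i hi => by rw [hu i (Finset.ne_of_mem_erase hi)]
  refine ⟨u, fun e he => ?_, ?_⟩
  · by_cases hee : e = e₀
    · rw [hee, hu0]
      exact mul_ne_zero (Real.exp_pos _).ne' (hx0 e₀ h₀)
    · rw [hu e hee]
      exact (ht e he).1
  · funext e
    by_cases hee : e = e₀
    · subst hee
      rw [monomialChart_base, hoff, hu0, ← mul_assoc, ← Real.exp_add, neg_add_cancel, Real.exp_zero,
        one_mul]
    · by_cases he : e ∈ T
      · rw [monomialChart_of_mem he hee, hu e hee, (ht e he).2]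
      · rw [monomialChart_of_notMem h₀ he, hu e hee, ht' e he]

variable [Fintype E]

/-- The graph of one coordinate as a function of the others is a null set. -/
lemma volume_setOf_eq_eq_zero (e : E) {f : (E → ℝ) → ℝ} (hf : Measurable f)
    (hfe : ∀ x t, f (Function.update x e t) = f x) :
    volume {x : E → ℝ | x e = f x} = 0 := by
  have hs : MeasurableSet {x : E → ℝ | x e = f x} :=
    measurableSet_eq_fun (measurable_pi_apply e) hf
  have hind : Measurable ({x : E → ℝ | x e = f x}.indicator (1 : (E → ℝ) → ENNReal)) :=
    measurable_one.indicator hs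
  rw [← lintegral_indicator_one hs, volume_pi]
  have h1 := congrFun (lmarginal_univ (μ := fun _ : E => (volume : Measure ℝ))
    (f := {x : E → ℝ | x e = f x}.indicator 1)) 0
  rw [← h1, lmarginal_erase' _ hind (Finset.mem_univ e)]
  have h2 : (fun x : E → ℝ => ∫⁻ t, {x : E → ℝ | x e = f x}.indicator 1
      (Function.update x e t) ∂(volume : Measure ℝ)) = fun _ => (0 : ENNReal) := by
    funext x
    have h3 : (fun t => {x : E → ℝ | x e = f x}.indicator (1 : (E → ℝ) → ENNReal)
        (Function.update x e t)) = ({f x} : Set ℝ).indicator 1 := by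
      funext t
      simp [Set.indicator, hfe]
    rw [h3, lintegral_indicator_one (measurableSet_singleton _), Real.volume_singleton]
  rw [h2]
  simp [lmarginal]

/-- The Jacobian matrix of `monomialChart`. -/
noncomputable def monomialChartJacobian (T : Finset E) (e₀ : E) (L : ℝ) (u : E → ℝ) :
    Matrix E E ℝ := Matrix.of fun i j =>
  if i = e₀ then
    if j = e₀ then Real.exp (-(L * (1 - offSum T e₀ u)))
    else if j ∈ T then L * SignType.sign (u j) * (Real.exp (-(L * (1 - offSum T e₀ u))) * u e₀)
    else 0
  else if i = j then if i ∈ T then -(L * Real.exp (-(L * |u i|))) else 1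
  else 0

lemma hasFDerivAt_monomialChart {T : Finset E} {e₀ : E} (L : ℝ) {u : E → ℝ}
    (hu : ∀ e ∈ T, u e ≠ 0) :
    HasFDerivAt (monomialChart T e₀ L)
      (LinearMap.toContinuousLinearMap (Matrix.toLin' (monomialChartJacobian T e₀ L u))) u := by
  rw [hasFDerivAt_pi']
  intro e
  by_cases he : e = e₀
  · subst he
    have h1 : HasFDerivAt (offSum T e)
        (∑ i ∈ T.erase e, (SignType.sign (u i) : ℝ) • ContinuousLinearMap.proj (R := ℝ)
          (φ := fun _ : E => ℝ) i) u := by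
      unfold offSum
      refine HasFDerivAt.fun_sum fun i hi => ?_
      exact (hasDerivAt_abs (hu i (Finset.mem_of_mem_erase hi))).comp_hasFDerivAt u
        (hasFDerivAt_apply (𝕜 := ℝ) i u)
    have h3 : HasFDerivAt (fun y => -(L * (1 - offSum T e y))) _ u :=
      ((h1.const_sub 1).const_mul L).neg
    have h2 := h3.exp.mul (hasFDerivAt_apply (𝕜 := ℝ) e u)
    refine (h2.congr_of_eventuallyEq (Eventually.of_forall fun v => ?_)).congr_fderiv ?_
    · simp [monomialChart_base]
    · ext v
      simp only [add_apply, smul_apply,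
        _root_.neg_apply, sum_apply,
        ContinuousLinearMap.proj_apply, ContinuousLinearMap.comp_apply, smul_eq_mul,
        LinearMap.coe_toContinuousLinearMap', Matrix.toLin'_apply, Matrix.mulVec, dotProduct,
        monomialChartJacobian, Matrix.of_apply, if_true]
      rw [← Finset.add_sum_erase _ _ (Finset.mem_univ e), if_pos rfl]
      have h3 : ∑ j ∈ Finset.univ.erase e, (if j = e then Real.exp (-(L * (1 - offSum T e u)))
          else if j ∈ T then L * SignType.sign (u j) *
            (Real.exp (-(L * (1 - offSum T e u))) * u e) else 0) * v j
          = ∑ j ∈ T.erase e, L * SignType.sign (u j) *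
            (Real.exp (-(L * (1 - offSum T e u))) * u e) * v j := by
        symm
        refine Finset.sum_subset_zero_on_sdiff (Finset.erase_subset_erase _ (Finset.subset_univ _))
          (fun j hj => ?_) (fun j hj => ?_)
        · simp only [Finset.mem_sdiff, Finset.mem_erase, Finset.mem_univ, and_true, not_and] at hj
          simp [hj.1, hj.2 hj.1]
        · simp [Finset.ne_of_mem_erase hj, Finset.mem_of_mem_erase hj]
      rw [h3]
      have h4 : ∑ j ∈ T.erase e, L * SignType.sign (u j) *
            (Real.exp (-(L * (1 - offSum T e u))) * u e) * v j
          = L * (Real.exp (-(L * (1 - offSum T e u))) * u e) *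
            ∑ j ∈ T.erase e, SignType.sign (u j) * v j := by
        rw [Finset.mul_sum]
        exact Finset.sum_congr rfl fun j _ => by ring
      rw [h4]
      ring
  · by_cases heT : e ∈ T
    · have h1 := (hasDerivAt_signExp L (hu e heT)).comp_hasFDerivAt u (hasFDerivAt_apply (𝕜 := ℝ) e u)
      refine (h1.congr_of_eventuallyEq (Eventually.of_forall fun v => ?_)).congr_fderiv ?_
      · simp [monomialChart_of_mem heT he]
      · ext v
        simp [monomialChartJacobian, he, heT, Matrix.mulVec, dotProduct]
    · have h1 := hasFDerivAt_apply (𝕜 := ℝ) e u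
      refine (h1.congr_of_eventuallyEq (Eventually.of_forall fun v => ?_)).congr_fderiv ?_
      · simp [monomialChart, he, heT]
      · ext v
        simp [monomialChartJacobian, he, heT, Matrix.mulVec, dotProduct]

/-- The Jacobian determinant of `monomialChart` has constant absolute value. -/
lemma abs_det_monomialChartJacobian {T : Finset E} {e₀ : E} (h₀ : e₀ ∈ T) {L : ℝ} (hL : 0 < L)
    (u : E → ℝ) :
    |(monomialChartJacobian T e₀ L u).det| = Real.exp (-L) * L ^ (T.card - 1) := by
  let d : E → ℝ := fun e => if e = e₀ then Real.exp (-(L * (1 - offSum T e₀ u))) else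
    if e ∈ T then -(L * Real.exp (-(L * |u e|))) else 1
  let c : E → ℝ := fun e => if e = e₀ then 0 else if e ∈ T then L * SignType.sign (u e) * u e₀ else 0
  -- Column operations clear the row of `e₀`, the only one with off-diagonal entries.
  have h1 : (monomialChartJacobian T e₀ L u).det = (Matrix.diagonal d).det := by
    rw [← Matrix.det_transpose, ← Matrix.det_transpose (Matrix.diagonal d)]
    refine Matrix.det_eq_of_forall_row_eq_smul_add_const c e₀ (by simp [c]) fun j i => ?_
    simp only [Matrix.transpose_apply, monomialChartJacobian, Matrix.of_apply,
      Matrix.diagonal_apply, c, d]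
    by_cases hi : i = e₀
    · subst hi
      by_cases hj : j = i
      · simp [hj]
      · by_cases hjT : j ∈ T
        · simp [hj, Ne.symm hj, hjT]
          ring
        · simp [hj, Ne.symm hj, hjT]
    · by_cases hij : i = j
      · subst hij
        simp [hi]
      · simp [hi, hij]
  have h2 : ∏ e, d e = Real.exp (-(L * (1 - offSum T e₀ u))) *
      ∏ e ∈ T.erase e₀, -(L * Real.exp (-(L * |u e|))) := by
    rw [← Finset.mul_prod_erase _ _ (Finset.mem_univ e₀)]
    congr 1
    · simp [d]
    · symm
      refine Finset.prod_subset_one_on_sdiff (Finset.erase_subset_erase _ (Finset.subset_univ _))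
          (fun j hj => ?_) (fun j hj => ?_)
      · simp only [Finset.mem_sdiff, Finset.mem_erase, Finset.mem_univ, and_true, not_and] at hj
        simp [d, hj.1, hj.2 hj.1]
      · simp [d, Finset.ne_of_mem_erase hj, Finset.mem_of_mem_erase hj]
  rw [h1, Matrix.det_diagonal, h2, abs_mul, abs_of_pos (Real.exp_pos _), Finset.abs_prod]
  simp only [abs_neg, abs_mul, abs_of_pos hL, abs_of_pos (Real.exp_pos _)]
  rw [Finset.prod_mul_distrib, Finset.prod_const, Finset.card_erase_of_mem h₀, ← Real.exp_sum,
    Finset.sum_neg_distrib, ← Finset.mul_sum, mul_left_comm, ← Real.exp_add, ← offSum, mul_comm]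
  congr 2
  ring

lemma ae_forall_ne_zero : ∀ᵐ u : E → ℝ, ∀ e, u e ≠ 0 := by
  rw [ae_all_iff]
  intro e
  have h := volume_setOf_eq_eq_zero e (f := fun _ : E → ℝ => (0 : ℝ)) measurable_const
    fun _ _ => rfl
  rw [ae_iff]
  simpa using h

/-- Change of variables along `monomialChart`. -/
lemma integral_eq_integral_comp_monomialChart {T : Finset E} {e₀ : E} (h₀ : e₀ ∈ T) {L : ℝ}
    (hL : 0 < L) (F : (E → ℝ) → ℝ) (hF : ∀ x, F x ≠ 0 → ∀ e ∈ T, |x e| < 1) :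
    ∫ x, F x = Real.exp (-L) * L ^ (T.card - 1) * ∫ u, F (monomialChart T e₀ L u) := by
  let U : Set (E → ℝ) := {u | ∀ e ∈ T, u e ≠ 0}
  have hU : MeasurableSet U := by
    have : U = ⋂ e ∈ T, {u : E → ℝ | u e ≠ 0} := by
      ext
      simp [U]
    rw [this]
    refine Finset.measurableSet_biInter _ fun e _ => ?_
    exact (measurableSet_eq_fun (measurable_pi_apply e) measurable_const).compl
  have hUae : ∀ᵐ u, u ∈ U := by
    filter_upwards [ae_forall_ne_zero (E := E)] with u hu e _ using hu e
  have h1 := integral_image_eq_integral_abs_det_fderiv_smul volume hU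
    (fun u hu => (hasFDerivAt_monomialChart (e₀ := e₀) L hu).hasFDerivWithinAt)
    (monomialChart_injective h₀ hL).injOn F
  have h2 : ∫ x in monomialChart T e₀ L '' U, F x = ∫ x, F x := by
    refine setIntegral_eq_integral_of_ae_compl_eq_zero ?_
    filter_upwards [ae_forall_ne_zero (E := E)] with x hx hxU
    by_contra hne
    obtain ⟨u, hu, rfl⟩ := exists_monomialChart_eq h₀ hL (fun e _ => hx e) (hF x hne)
    exact hxU ⟨u, hu, rfl⟩
  have h3 : ∀ u, |(LinearMap.toContinuousLinearMap
      (Matrix.toLin' (monomialChartJacobian T e₀ L u))).det| =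
      Real.exp (-L) * L ^ (T.card - 1) := by
    intro u
    rw [LinearMap.det_toContinuousLinearMap, LinearMap.det_toLin',
      abs_det_monomialChartJacobian h₀ hL]
  simp only [h3, smul_eq_mul] at h1
  rw [← h2, h1, integral_const_mul, setIntegral_eq_integral_of_ae_compl_eq_zero]
  filter_upwards [hUae] with u hu hn using absurd hu hn

/-! ### Domination and dominated convergence in the adapted coordinates -/

/-- An integrable function that dominates, up to a constant factor and in the coordinates
`monomialChart T e₀ L`, the indicator functions of the sets `∏ e ∈ T, |x e| ≤ c * exp (-L)` in the cube, uniformly in `L`. -/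
noncomputable def chartDominator (T : Finset E) (e₀ : E) (c : ℝ) (u : E → ℝ) : ℝ :=
  ∏ e, (if e = e₀ then fun s : ℝ => if |s| ≤ c then (√|s|)⁻¹ else 0
    else if e ∈ T then fun s => Real.exp (-(|s| / 2))
    else (Set.Icc (-1) 1).indicator 1) (u e)

lemma integrable_chartDominator (T : Finset E) (e₀ : E) (c : ℝ) :
    Integrable (chartDominator T e₀ c) := by
  unfold chartDominator
  refine Integrable.fintype_prod fun e => ?_
  split_ifs
  · exact integrable_inv_sqrt_abs c
  · exact integrable_exp_neg_half_abs
  · exact (integrable_indicator_iff measurableSet_Icc).mpr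
      (integrableOn_const (C := (1 : ℝ)) (by simp))

lemma one_le_chartDominator {T : Finset E} {e₀ : E} (h₀ : e₀ ∈ T) {c L : ℝ} (hc : 1 ≤ c)
    (hL : 1 ≤ L) {u : E → ℝ} (hu : u e₀ ≠ 0) (hcube : ∀ e, |monomialChart T e₀ L u e| < 1)
    (hprod : ∏ e ∈ T, |monomialChart T e₀ L u e| ≤ c * Real.exp (-L)) :
    1 ≤ √(c * Real.exp 1) * chartDominator T e₀ (c * Real.exp 1) u := by
  have hu' : 0 < |u e₀| := abs_pos.mpr hu
  have h1 : |u e₀| ≤ c := by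
    rw [prod_abs_monomialChart h₀, mul_comm] at hprod
    exact le_of_mul_le_mul_right hprod (Real.exp_pos _)
  have he1 : 1 ≤ Real.exp 1 := Real.one_le_exp zero_le_one
  have h2 : |u e₀| ≤ c * Real.exp 1 := h1.trans (le_mul_of_one_le_right (by linarith) he1)
  -- The bound `|u e₀| ≤ c` is enough while the exponents sum to at most one; beyond that, the
  -- condition `|x e₀| < 1` takes over.
  have h3 : |u e₀| * Real.exp (offSum T e₀ u) ≤ c * Real.exp 1 := by
    rcases le_or_gt (offSum T e₀ u) 1 with h | h
    · exact mul_le_mul h1 (Real.exp_le_exp.mpr h) (Real.exp_pos _).le (by linarith)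
    · have h4 := hcube e₀
      rw [monomialChart_base, abs_mul, abs_of_pos (Real.exp_pos _)] at h4
      have h5 : Real.exp (offSum T e₀ u - 1) ≤ Real.exp (-(L * (1 - offSum T e₀ u))) :=
        Real.exp_le_exp.mpr (by nlinarith)
      have h6 : Real.exp (offSum T e₀ u - 1) * |u e₀| ≤ 1 :=
        (mul_le_mul_of_nonneg_right h5 hu'.le).trans h4.le
      have h7 : |u e₀| * Real.exp (offSum T e₀ u) =
          (Real.exp (offSum T e₀ u - 1) * |u e₀|) * Real.exp 1 := by
        rw [mul_right_comm, ← Real.exp_add, sub_add_cancel, mul_comm]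
      rw [h7]
      exact mul_le_mul_of_nonneg_right (h6.trans hc) (Real.exp_pos _).le
  have h4 : chartDominator T e₀ (c * Real.exp 1) u =
      (√|u e₀|)⁻¹ * ∏ e ∈ T.erase e₀, Real.exp (-(|u e| / 2)) := by
    unfold chartDominator
    rw [← Finset.mul_prod_erase _ _ (Finset.mem_univ e₀), if_pos rfl]
    simp only [if_pos h2]
    congr 1
    symm
    refine Finset.prod_subset_one_on_sdiff (Finset.erase_subset_erase _ (Finset.subset_univ _))
      (fun j hj => ?_) (fun j hj => ?_)
    · simp only [Finset.mem_sdiff, Finset.mem_erase, Finset.mem_univ, and_true, not_and] at hj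
      have hj1 := hcube j
      rw [monomialChart_of_notMem h₀ (hj.2 hj.1), abs_lt] at hj1
      simp [hj.1, hj.2 hj.1, Set.indicator, hj1.1.le, hj1.2.le]
    · simp [Finset.ne_of_mem_erase hj, Finset.mem_of_mem_erase hj]
  have h5 : ∏ e ∈ T.erase e₀, Real.exp (-(|u e| / 2)) = (√(Real.exp (offSum T e₀ u)))⁻¹ := by
    rw [← Real.exp_sum, Finset.sum_neg_distrib, ← Finset.sum_div, Real.exp_neg, Real.exp_half]
    rfl
  rw [h4, h5, ← mul_inv, ← Real.sqrt_mul hu'.le, ← div_eq_mul_inv,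
    one_le_div (Real.sqrt_pos.mpr (mul_pos hu' (Real.exp_pos _)))]
  exact Real.sqrt_le_sqrt h3

/-- `F` is bounded by `M` and vanishes outside the part of the open cube `(-1, 1)^E` where
`∏ e ∈ T, |x e| ≤ c * exp (-L)`. -/
def SupportedNear (T : Finset E) (c M L : ℝ) (F : (E → ℝ) → ℝ) : Prop :=
  ∀ x, |F x| ≤ M ∧ (F x ≠ 0 → (∀ e, |x e| < 1) ∧ ∏ e ∈ T, |x e| ≤ c * Real.exp (-L))

lemma SupportedNear.abs_le {T : Finset E} {e₀ : E} (h₀ : e₀ ∈ T) {c M L : ℝ} (hc : 1 ≤ c)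
    (hM : 0 ≤ M) (hL : 1 ≤ L) {F : (E → ℝ) → ℝ} (hF : SupportedNear T c M L F) {u : E → ℝ}
    (hu : u e₀ ≠ 0) :
    |F (monomialChart T e₀ L u)| ≤
      M * (√(c * Real.exp 1) * |chartDominator T e₀ (c * Real.exp 1) u|) := by
  by_cases h : F (monomialChart T e₀ L u) = 0
  · rw [h, abs_zero]
    positivity
  · obtain ⟨h1, h2⟩ := (hF (monomialChart T e₀ L u)).2 h
    have h3 := one_le_chartDominator h₀ hc hL hu h1 h2
    have h4 : 1 ≤ √(c * Real.exp 1) * |chartDominator T e₀ (c * Real.exp 1) u| :=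
      h3.trans (mul_le_mul_of_nonneg_left (le_abs_self _) (Real.sqrt_nonneg _))
    calc _ ≤ M * 1 := by rw [mul_one]; exact (hF _).1
      _ ≤ _ := mul_le_mul_of_nonneg_left h4 hM

lemma SupportedNear.integral_eq {T : Finset E} {e₀ : E} (h₀ : e₀ ∈ T) {c M L : ℝ} (hL : 1 ≤ L)
    {F : (E → ℝ) → ℝ} (hF : SupportedNear T c M L F) :
    (∫ x, F x) / (Real.exp (-L) * L ^ (T.card - 1)) = ∫ u, F (monomialChart T e₀ L u) := by
  have hL0 : 0 < L := by linarith
  rw [integral_eq_integral_comp_monomialChart h₀ hL0 F fun x hx e _ => ((hF x).2 hx).1 e]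
  exact mul_div_cancel_left₀ _ (mul_pos (Real.exp_pos _) (pow_pos hL0 _)).ne'

/-- Functions concentrated near `∏ e ∈ T, x e = 0` at scale `exp (-L)` have integrals of order at
most `exp (-L) * L ^ (#T - 1)`. -/
lemma tendsto_integral_div_zero_of_supportedNear {T : Finset E} {e₀ : E} (h₀ : e₀ ∈ T) {c M : ℝ}
    (hc : 1 ≤ c) (hM : 0 ≤ M) {F : ℝ → (E → ℝ) → ℝ} (hF : ∀ L, SupportedNear T c M L (F L))
    {m : ℕ} (hm : T.card < m) :
    Tendsto (fun L => (∫ x, F L x) / (Real.exp (-L) * L ^ (m - 1))) atTop (𝓝 0) := by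
  have hcard : 0 < T.card := Finset.card_pos.mpr ⟨e₀, h₀⟩
  set B : ℝ := ∫ u, M * (√(c * Real.exp 1) * |chartDominator T e₀ (c * Real.exp 1) u|) with hB
  have hint : Integrable fun u =>
      M * (√(c * Real.exp 1) * |chartDominator T e₀ (c * Real.exp 1) u|) :=
    ((integrable_chartDominator T e₀ (c * Real.exp 1)).abs.const_mul _).const_mul _
  have hbound : ∀ L, 1 ≤ L → ‖∫ u, F L (monomialChart T e₀ L u)‖ ≤ B := by
    intro L hL
    refine norm_integral_le_of_norm_le hint ?_
    filter_upwards [ae_forall_ne_zero (E := E)] with u hu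
    exact (hF L).abs_le h₀ hc hM hL (hu e₀)
  have h1 : Tendsto (fun L : ℝ => B * (L ^ (m - T.card))⁻¹) atTop (𝓝 0) := by
    have := (tendsto_pow_atTop (α := ℝ) (n := m - T.card) (by omega)).inv_tendsto_atTop.const_mul B
    simpa using this
  refine squeeze_zero_norm' ?_ h1
  filter_upwards [eventually_ge_atTop 1] with L hL
  have hL0 : 0 < L := by linarith
  have h2 : (∫ x, F L x) / (Real.exp (-L) * L ^ (m - 1)) =
      (∫ u, F L (monomialChart T e₀ L u)) * (L ^ (m - T.card))⁻¹ := by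
    have h3 : m - 1 = (T.card - 1) + (m - T.card) := by omega
    rw [← (hF L).integral_eq h₀ hL, h3, pow_add, ← mul_assoc, div_mul_eq_div_div, div_eq_mul_inv]
  rw [h2, norm_mul, norm_inv, norm_pow, Real.norm_of_nonneg hL0.le]
  exact mul_le_mul_of_nonneg_right (hbound L hL) (by positivity)

/-- Dominated convergence in the coordinates `monomialChart`. -/
lemma tendsto_integral_div_of_supportedNear {T : Finset E} {e₀ : E} (h₀ : e₀ ∈ T) {c M : ℝ}
    (hc : 1 ≤ c) (hM : 0 ≤ M) {F : ℝ → (E → ℝ) → ℝ} (hF : ∀ L, SupportedNear T c M L (F L))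
    (hFm : ∀ L, Measurable (F L)) {g : (E → ℝ) → ℝ}
    (hlim : ∀ᵐ u, Tendsto (fun L => F L (monomialChart T e₀ L u)) atTop (𝓝 (g u))) :
    Integrable g ∧ Tendsto (fun L => (∫ x, F L x) / (Real.exp (-L) * L ^ (T.card - 1))) atTop
      (𝓝 (∫ u, g u)) := by
  have hint : Integrable fun u =>
      M * (√(c * Real.exp 1) * |chartDominator T e₀ (c * Real.exp 1) u|) :=
    ((integrable_chartDominator T e₀ (c * Real.exp 1)).abs.const_mul _).const_mul _
  have hmeas : ∀ L, AEStronglyMeasurable (fun u => F L (monomialChart T e₀ L u)) :=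
    fun L => ((hFm L).comp (measurable_monomialChart T e₀ L)).aestronglyMeasurable
  constructor
  · refine hint.mono' (aestronglyMeasurable_of_tendsto_ae atTop hmeas hlim) ?_
    filter_upwards [hlim, ae_forall_ne_zero (E := E)] with u hu hu0
    refine le_of_tendsto hu.norm ?_
    filter_upwards [eventually_ge_atTop 1] with L hL
    exact (hF L).abs_le h₀ hc hM hL (hu0 e₀)
  · refine Tendsto.congr' (f₁ := fun L => ∫ u, F L (monomialChart T e₀ L u)) ?_ ?_
    · filter_upwards [eventually_ge_atTop 1] with L hL
      exact ((hF L).integral_eq h₀ hL).symm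
    · refine tendsto_integral_filter_of_dominated_convergence _ (Eventually.of_forall hmeas) ?_
        hint hlim
      filter_upwards [eventually_ge_atTop 1] with L hL
      filter_upwards [ae_forall_ne_zero (E := E)] with u hu
      exact (hF L).abs_le h₀ hc hM hL (hu e₀)

/-! ### Competition between monomials -/

omit [Fintype E] in
/-- The coordinates in `T` tend to zero as long as their exponents sum to less than one. -/
lemma tendsto_monomialChart {T : Finset E} {e₀ : E} (h₀ : e₀ ∈ T) {u : E → ℝ}
    (hu : ∀ e, u e ≠ 0) (hoff : offSum T e₀ u < 1) :
    Tendsto (fun L => monomialChart T e₀ L u) atTop (𝓝 fun e => if e ∈ T then 0 else u e) := by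
  rw [tendsto_pi_nhds]
  intro e
  have hexp : ∀ r : ℝ, 0 < r → Tendsto (fun L : ℝ => Real.exp (-(L * r))) atTop (𝓝 0) :=
    fun r hr => Real.tendsto_exp_neg_atTop_nhds_zero.comp (tendsto_id.atTop_mul_const hr)
  by_cases he : e ∈ T
  · rw [if_pos he]
    by_cases hee : e = e₀
    · subst hee
      simp only [monomialChart_base]
      simpa using (hexp (1 - offSum T e u) (by linarith)).mul_const (u e)
    · simp only [monomialChart_of_mem he hee]
      rw [tendsto_zero_iff_abs_tendsto_zero]
      simp only [Function.comp_def, abs_signExp]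
      exact hexp _ (abs_pos.mpr (hu e))
  · simp only [if_neg he, monomialChart_of_notMem h₀ he]
    exact tendsto_const_nhds

/-- The set where the weighted monomial `|∏ e ∈ T, x e| * h x` is at most `exp (-L)`. -/
def monomialSublevel (T : Finset E) (h : (E → ℝ) → ℝ) (L : ℝ) : Set (E → ℝ) :=
  {x | (∏ e ∈ T, |x e|) * h x ≤ Real.exp (-L)}

omit [DecidableEq E] [Fintype E] in
lemma measurableSet_monomialSublevel [Finite E] (T : Finset E) {h : (E → ℝ) → ℝ}
    (hh : Continuous h) (L : ℝ) : MeasurableSet (monomialSublevel T h L) :=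
  (isClosed_le (by fun_prop) continuous_const).measurableSet

omit [Fintype E] in
/-- In the regime where `∏ e ∈ T, x e` is of order `exp (-L)` with all exponents positive, every
monomial that is not a multiple of it is much larger than `exp (-L)`. -/
lemma eventually_notMem_monomialSublevel {T T' : Finset E} {e₀ : E} (h₀ : e₀ ∈ T)
    (hT : T' ≠ T) (hcard : T'.card ≤ T.card) {h : (E → ℝ) → ℝ} (hh : Continuous h)
    (hpos : ∀ x, 0 < h x) {u : E → ℝ} (hu : ∀ e, u e ≠ 0) (hoff : offSum T e₀ u < 1) :
    ∀ᶠ L in atTop, monomialChart T e₀ L u ∉ monomialSublevel T' h L := by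
  have hlim := tendsto_monomialChart h₀ hu hoff
  set y : E → ℝ := fun e => if e ∈ T then 0 else u e with hy
  have hne : (T \ T').Nonempty := by
    rw [Finset.sdiff_nonempty]
    exact fun hsub => hT (Finset.eq_of_subset_of_card_le hsub hcard).symm
  have h1 : Tendsto (fun L => ∏ e ∈ T \ T', |monomialChart T e₀ L u e|) atTop (𝓝 0) := by
    have h2 : Tendsto (fun L => ∏ e ∈ T \ T', |monomialChart T e₀ L u e|) atTop
        (𝓝 (∏ e ∈ T \ T', |y e|)) :=
      tendsto_finsetProd _ fun e _ => ((tendsto_pi_nhds.mp hlim) e).abs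
    obtain ⟨e, he⟩ := hne
    rwa [Finset.prod_eq_zero he (by simp [hy, (Finset.mem_sdiff.mp he).1])] at h2
  set κ : ℝ := ∏ e ∈ T' \ T, |u e| with hκ
  have hκ0 : 0 < κ := Finset.prod_pos fun e _ => abs_pos.mpr (hu e)
  have h2 : Tendsto (fun L => κ * |u e₀| * h (monomialChart T e₀ L u)) atTop
      (𝓝 (κ * |u e₀| * h y)) := ((hh.tendsto y).comp hlim).const_mul _
  have h3 : 0 < κ * |u e₀| * h y := mul_pos (mul_pos hκ0 (abs_pos.mpr (hu e₀))) (hpos y)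
  filter_upwards [h1.eventually_lt h2 h3] with L hL hmem
  set x := monomialChart T e₀ L u with hx
  have h4 : ∏ e ∈ T' \ T, |x e| = κ := Finset.prod_congr rfl fun e he => by
    rw [hx, monomialChart_of_notMem h₀ (Finset.mem_sdiff.mp he).2]
  have h5 : (∏ e ∈ T \ T', |x e|) * ∏ e ∈ T', |x e| = κ * (Real.exp (-L) * |u e₀|) := by
    rw [← prod_abs_monomialChart h₀ L u, ← h4, ← Finset.prod_union Finset.sdiff_disjoint,
      ← Finset.prod_union Finset.sdiff_disjoint, Finset.sdiff_union_self_eq_union,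
      Finset.sdiff_union_self_eq_union, Finset.union_comm]
  have h6 : (∏ e ∈ T', |x e|) * h x ≤ Real.exp (-L) := hmem
  have h7 : κ * (Real.exp (-L) * |u e₀|) * h x ≤ (∏ e ∈ T \ T', |x e|) * Real.exp (-L) := by
    rw [← h5, mul_assoc]
    exact mul_le_mul_of_nonneg_left h6 (Finset.prod_nonneg fun e _ => abs_nonneg _)
  have h8 : (κ * |u e₀| * h x) * Real.exp (-L) ≤ (∏ e ∈ T \ T', |x e|) * Real.exp (-L) := by
    linarith
  exact absurd (le_of_mul_le_mul_right h8 (Real.exp_pos _)) (not_le.mpr hL)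

/-! ### Unions of sublevel sets of weighted monomials -/

section Union

variable (𝒯 : Finset (Finset E)) (h : Finset E → (E → ℝ) → ℝ) (φ : (E → ℝ) → ℝ)

open Classical in
/-- The number of sublevel sets of the family that contain `x`. -/
noncomputable def sublevelCount (L : ℝ) (x : E → ℝ) : ℝ :=
  ∑ T ∈ 𝒯, if x ∈ monomialSublevel T (h T) L then 1 else 0

open Classical in
/-- The share of the sublevel set of `T` in the mass of the union of the family: the density `φ`,
divided equally among the sublevel sets containing the point. -/
noncomputable def sublevelShare (T : Finset E) (L : ℝ) (x : E → ℝ) : ℝ :=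
  if (∀ e, |x e| < 1) ∧ x ∈ monomialSublevel T (h T) L then φ x / sublevelCount 𝒯 h L x else 0

omit [Fintype E] [DecidableEq E] in
lemma one_le_sublevelCount {T : Finset E} (hT : T ∈ 𝒯) {L : ℝ} {x : E → ℝ}
    (hx : x ∈ monomialSublevel T (h T) L) : 1 ≤ sublevelCount 𝒯 h L x := by
  classical
  have := Finset.single_le_sum (f := fun T => if x ∈ monomialSublevel T (h T) L then (1 : ℝ) else 0)
    (fun T _ => by positivity) hT
  rwa [if_pos hx] at this

omit [DecidableEq E] in
open Classical in
/-- The shares add up to the density restricted to the union. -/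
lemma sum_sublevelShare (L : ℝ) (x : E → ℝ) :
    ∑ T ∈ 𝒯, sublevelShare 𝒯 h φ T L x =
      if (∀ e, |x e| < 1) ∧ ∃ T ∈ 𝒯, x ∈ monomialSublevel T (h T) L then φ x else 0 := by
  by_cases hx : ∀ e, |x e| < 1
  · by_cases hT : ∃ T ∈ 𝒯, x ∈ monomialSublevel T (h T) L
    · rw [if_pos ⟨hx, hT⟩]
      obtain ⟨T, hT, hxT⟩ := hT
      have h1 := one_le_sublevelCount 𝒯 h hT hxT
      have h2 : ∀ T, sublevelShare 𝒯 h φ T L x =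
          (if x ∈ monomialSublevel T (h T) L then 1 else 0) * (φ x / sublevelCount 𝒯 h L x) := by
        intro T
        simp only [sublevelShare, hx, implies_true, true_and, ite_mul, one_mul, zero_mul]
      simp only [h2]
      rw [← Finset.sum_mul, ← sublevelCount, mul_div_cancel₀ _ (by linarith)]
    · rw [if_neg fun h => hT h.2]
      refine Finset.sum_eq_zero fun T hTm => ?_
      rw [sublevelShare, if_neg fun h => hT ⟨T, hTm, h.2⟩]
  · rw [if_neg fun h => hx h.1]
    refine Finset.sum_eq_zero fun T _ => ?_
    rw [sublevelShare, if_neg fun h => hx h.1]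

variable {𝒯 h φ}

omit [DecidableEq E] in
lemma measurable_sublevelShare (hh : ∀ T ∈ 𝒯, Continuous (h T)) (hφ : Continuous φ) {T : Finset E}
    (hT : T ∈ 𝒯) (L : ℝ) : Measurable (sublevelShare 𝒯 h φ T L) := by
  classical
  have h1 : Measurable (sublevelCount 𝒯 h L) := by
    unfold sublevelCount
    refine Finset.measurable_fun_sum _ fun T hT => ?_
    exact Measurable.ite (measurableSet_monomialSublevel T (hh T hT) L) measurable_const
      measurable_const
  have h2 : MeasurableSet {x : E → ℝ | ∀ e, |x e| < 1} := by
    rw [Set.ofPred_forall]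
    exact MeasurableSet.iInter fun e => (isOpen_lt (by fun_prop) continuous_const).measurableSet
  unfold sublevelShare
  exact Measurable.ite (h2.inter (measurableSet_monomialSublevel T (hh T hT) L))
    (hφ.measurable.div h1) measurable_const

omit [DecidableEq E] in
lemma exists_supportedNear_sublevelShare (hφ : Continuous φ) {T : Finset E} (hT : T ∈ 𝒯)
    (hh : Continuous (h T)) (hpos : ∀ x, 0 < h T x) :
    ∃ c M : ℝ, 1 ≤ c ∧ 0 ≤ M ∧ ∀ L, SupportedNear T c M L (sublevelShare 𝒯 h φ T L) := by
  have hcomp : IsCompact (Set.Icc (fun _ : E => (-1 : ℝ)) fun _ => 1) := isCompact_Icc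
  have hmem : ∀ x : E → ℝ, (∀ e, |x e| < 1) → x ∈ Set.Icc (fun _ : E => (-1 : ℝ)) fun _ => 1 :=
    fun x hx => ⟨fun e => (abs_lt.mp (hx e)).1.le, fun e => (abs_lt.mp (hx e)).2.le⟩
  obtain ⟨M, hM⟩ := hcomp.exists_bound_of_continuousOn hφ.continuousOn
  obtain ⟨c, hc⟩ := hcomp.exists_bound_of_continuousOn
    (f := fun x => (h T x)⁻¹) (hh.inv₀ fun x => (hpos x).ne').continuousOn
  refine ⟨max 1 c, max 0 M, le_max_left _ _, le_max_left _ _, fun L x => ?_⟩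
  unfold sublevelShare
  split_ifs with hx
  · have h1 := one_le_sublevelCount 𝒯 h hT hx.2
    refine ⟨?_, fun _ => ⟨hx.1, ?_⟩⟩
    · rw [abs_div, abs_of_pos (by linarith : 0 < sublevelCount 𝒯 h L x)]
      exact (div_le_self (abs_nonneg _) h1).trans ((hM x (hmem x hx.1)).trans (le_max_right _ _))
    · have h2 : (∏ e ∈ T, |x e|) * h T x ≤ Real.exp (-L) := hx.2
      have h3 := hc x (hmem x hx.1)
      rw [norm_inv, Real.norm_of_nonneg (hpos x).le] at h3
      calc ∏ e ∈ T, |x e| ≤ Real.exp (-L) * (h T x)⁻¹ := by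
            rwa [← div_eq_mul_inv, le_div_iff₀ (hpos x)]
        _ ≤ Real.exp (-L) * max 1 c :=
            mul_le_mul_of_nonneg_left (h3.trans (le_max_right _ _)) (Real.exp_pos _).le
        _ = _ := mul_comm _ _
  · exact ⟨by rw [abs_zero]; exact le_max_left _ _, fun h => absurd rfl h⟩

/-- The region of the coordinates `monomialChart T e₀` that carries the limiting mass: the point
stays in the cube, the exponents of all coordinates in `T`, including that of `e₀`, are positive,
and the limiting weighted monomial is below its threshold. -/
def limitRegion (T : Finset E) (e₀ : E) (h : (E → ℝ) → ℝ) : Set (E → ℝ) :=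
  {u | (∀ e ∉ T, |u e| < 1) ∧ offSum T e₀ u < 1 ∧ |u e₀| * h (fun e => if e ∈ T then 0 else u e) < 1}

omit [Fintype E] in
lemma continuous_ite_mem_zero (T : Finset E) :
    Continuous fun (u : E → ℝ) (e : E) => if e ∈ T then 0 else u e := by
  refine continuous_pi fun e => ?_
  split_ifs
  · exact continuous_const
  · exact continuous_apply e

lemma isOpen_limitRegion (T : Finset E) (e₀ : E) {h : (E → ℝ) → ℝ} (hh : Continuous h) :
    IsOpen (limitRegion T e₀ h) := by
  have h1 : IsOpen {u : E → ℝ | ∀ e ∉ T, |u e| < 1} := by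
    simp only [Set.ofPred_forall]
    refine isOpen_iInter_of_finite fun e => isOpen_iInter_of_finite fun _ => ?_
    exact isOpen_lt (by fun_prop) continuous_const
  have h2 : Continuous fun u : E → ℝ => |u e₀| * h fun e => if e ∈ T then 0 else u e :=
    (continuous_apply e₀).abs.mul (hh.comp (continuous_ite_mem_zero T))
  exact h1.inter ((isOpen_lt (continuous_offSum T e₀) continuous_const).inter
    (isOpen_lt h2 continuous_const))

lemma ae_offSum_ne_one (T : Finset E) (e₀ : E) : ∀ᵐ u : E → ℝ, offSum T e₀ u ≠ 1 := by
  rcases (T.erase e₀).eq_empty_or_nonempty with h | ⟨i, hi⟩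
  · refine ae_of_all _ fun u => ?_
    simp [offSum, h]
  · -- On the exceptional set, `|u i|` is a function of the other coordinates.
    let f : (E → ℝ) → ℝ := fun u => 1 - ∑ j ∈ (T.erase e₀).erase i, |u j|
    have hf : Measurable f := by fun_prop
    have hfi : ∀ x t, f (Function.update x i t) = f x := by
      intro x t
      simp only [f]
      congr 1
      exact Finset.sum_congr rfl fun j hj => by
        rw [Function.update_of_ne (Finset.ne_of_mem_erase hj)]
    have h1 : ∀ᵐ u : E → ℝ, u i ≠ f u := by
      rw [ae_iff]
      simpa using volume_setOf_eq_eq_zero i hf hfi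
    have h2 : ∀ᵐ u : E → ℝ, u i ≠ -f u := by
      rw [ae_iff]
      simpa using volume_setOf_eq_eq_zero i hf.neg fun x t => congrArg Neg.neg (hfi x t)
    filter_upwards [h1, h2] with u hu1 hu2 hu
    have h3 : |u i| = f u := by
      rw [offSum, ← Finset.add_sum_erase _ _ hi] at hu
      simp only [f]
      linarith
    rcases abs_choice (u i) with h4 | h4
    · exact hu1 (h4 ▸ h3)
    · exact hu2 (by linarith)

lemma ae_abs_mul_ne_one {T : Finset E} {e₀ : E} (h₀ : e₀ ∈ T) {h : (E → ℝ) → ℝ}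
    (hh : Continuous h) :
    ∀ᵐ u : E → ℝ, |u e₀| * h (fun e => if e ∈ T then 0 else u e) ≠ 1 := by
  let f : (E → ℝ) → ℝ := fun u => (h fun e => if e ∈ T then 0 else u e)⁻¹
  have hf : Measurable f := (hh.comp (continuous_ite_mem_zero T)).measurable.inv
  have hfi : ∀ x t, f (Function.update x e₀ t) = f x := by
    intro x t
    simp only [f]
    congr 2
    funext e
    split_ifs with he
    · rfl
    · rw [Function.update_of_ne (fun hee : e = e₀ => he (hee ▸ h₀))]
  have h1 : ∀ᵐ u : E → ℝ, u e₀ ≠ f u := by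
    rw [ae_iff]
    simpa using volume_setOf_eq_eq_zero e₀ hf hfi
  have h2 : ∀ᵐ u : E → ℝ, u e₀ ≠ -f u := by
    rw [ae_iff]
    simpa using volume_setOf_eq_eq_zero e₀ hf.neg fun x t => congrArg Neg.neg (hfi x t)
  filter_upwards [h1, h2] with u hu1 hu2 hu
  have h3 : |u e₀| = f u := eq_inv_of_mul_eq_one_left hu
  rcases abs_choice (u e₀) with h4 | h4
  · exact hu1 (h4 ▸ h3)
  · exact hu2 (by linarith)

open Classical in
/-- In the coordinates adapted to a monomial of maximal degree in the family, the share of its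
sublevel set converges almost everywhere: near such a point no other member of the family
competes. -/
lemma tendsto_sublevelShare_monomialChart (hφ : Continuous φ) (hh : ∀ T ∈ 𝒯, Continuous (h T))
    (hpos : ∀ T ∈ 𝒯, ∀ x, 0 < h T x) {T : Finset E} (hT : T ∈ 𝒯) {e₀ : E} (h₀ : e₀ ∈ T)
    (hmax : ∀ T' ∈ 𝒯, T'.card ≤ T.card) :
    ∀ᵐ u, Tendsto (fun L => sublevelShare 𝒯 h φ T L (monomialChart T e₀ L u)) atTop
      (𝓝 ((limitRegion T e₀ (h T)).indicator
        (fun u => φ fun e => if e ∈ T then 0 else u e) u)) := by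
  filter_upwards [ae_forall_ne_zero (E := E), ae_offSum_ne_one T e₀,
    ae_abs_mul_ne_one h₀ (hh T hT)] with u hu hoff hne
  by_cases hcube : ∀ e ∉ T, |u e| < 1
  swap
  · have h1 : u ∉ limitRegion T e₀ (h T) := fun hm => hcube hm.1
    rw [Set.indicator_of_notMem h1]
    refine tendsto_const_nhds.congr fun L => ?_
    rw [sublevelShare, if_neg]
    rintro ⟨h2, -⟩
    refine hcube fun e he => ?_
    rw [← monomialChart_of_notMem h₀ he L u]
    exact h2 e
  rcases lt_or_gt_of_ne hoff with hlt | hgt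
  swap
  · have h1 : u ∉ limitRegion T e₀ (h T) := fun hm => lt_asymm hgt hm.2.1
    rw [Set.indicator_of_notMem h1]
    refine tendsto_const_nhds.congr' ?_
    have h2 : Tendsto (fun L : ℝ => Real.exp (L * (offSum T e₀ u - 1)) * |u e₀|) atTop atTop :=
      (Real.tendsto_exp_atTop.comp (tendsto_id.atTop_mul_const (by linarith))).atTop_mul_const
        (abs_pos.mpr (hu e₀))
    filter_upwards [h2.eventually_ge_atTop 1] with L hL
    rw [sublevelShare, if_neg]
    rintro ⟨h3, -⟩
    have h4 := h3 e₀
    rw [monomialChart_base, abs_mul, abs_of_pos (Real.exp_pos _),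
      show -(L * (1 - offSum T e₀ u)) = L * (offSum T e₀ u - 1) by ring] at h4
    exact absurd h4 (not_lt.mpr hL)
  have hlim := tendsto_monomialChart h₀ hu hlt
  set y : E → ℝ := fun e => if e ∈ T then 0 else u e with hy
  have hprodlim : Tendsto (fun L => |u e₀| * h T (monomialChart T e₀ L u)) atTop
      (𝓝 (|u e₀| * h T y)) := (((hh T hT).tendsto y).comp hlim).const_mul _
  have hmemiff : ∀ L, monomialChart T e₀ L u ∈ monomialSublevel T (h T) L ↔
      |u e₀| * h T (monomialChart T e₀ L u) ≤ 1 := by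
    intro L
    rw [monomialSublevel, Set.mem_ofPred_eq, prod_abs_monomialChart h₀, mul_assoc]
    exact mul_le_iff_le_one_right (Real.exp_pos _)
  rcases lt_or_gt_of_ne hne with hin | hout
  swap
  · have h1 : u ∉ limitRegion T e₀ (h T) := fun hm => lt_asymm hout hm.2.2
    rw [Set.indicator_of_notMem h1]
    refine tendsto_const_nhds.congr' ?_
    filter_upwards [hprodlim.eventually_const_lt hout] with L hL
    rw [sublevelShare, if_neg]
    rintro ⟨-, h3⟩
    exact absurd ((hmemiff L).mp h3) (not_le.mpr hL)
  have h1 : u ∈ limitRegion T e₀ (h T) := ⟨hcube, hlt, hin⟩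
  rw [Set.indicator_of_mem h1]
  refine Tendsto.congr' (f₁ := fun L => φ (monomialChart T e₀ L u)) ?_ ((hφ.tendsto y).comp hlim)
  have hother : ∀ᶠ L in atTop, ∀ T' ∈ 𝒯, T' ≠ T →
      monomialChart T e₀ L u ∉ monomialSublevel T' (h T') L := by
    rw [eventually_all_finset]
    intro T' hT'
    by_cases hTT : T' = T
    · exact Eventually.of_forall fun _ hn => absurd hTT hn
    · filter_upwards [eventually_notMem_monomialSublevel h₀ hTT (hmax T' hT') (hh T' hT')
        (hpos T' hT') hu hlt] with L hL _ using hL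
  have hy1 : ∀ e, |y e| < 1 := by
    intro e
    simp only [hy]
    split_ifs with he
    · simp
    · exact hcube e he
  have hcubeL : ∀ᶠ L in atTop, ∀ e, |monomialChart T e₀ L u e| < 1 := by
    rw [eventually_all]
    exact fun e => ((tendsto_pi_nhds.mp hlim) e).abs.eventually_lt_const (hy1 e)
  filter_upwards [hother, hcubeL, hprodlim.eventually_lt_const hin] with L hL1 hL2 hL3
  have hmem := (hmemiff L).mpr hL3.le
  have hcount : sublevelCount 𝒯 h L (monomialChart T e₀ L u) = 1 := by
    rw [sublevelCount, Finset.sum_eq_single_of_mem T hT, if_pos hmem]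
    intro T' hT' hTT
    rw [if_neg (hL1 T' hT' hTT)]
  rw [sublevelShare, if_pos ⟨hL2, hmem⟩, hcount, div_one]

open Classical in
/-- The mass of a union of sublevel sets of weighted monomials: only the monomials of maximal degree
`m` contribute to the leading order `r * (-log r) ^ (m - 1)`, where `r = exp (-L)`. -/
theorem exists_tendsto_integral_union (hφ : Continuous φ) (hφpos : ∀ x, 0 < φ x)
    (hh : ∀ T ∈ 𝒯, Continuous (h T)) (hpos : ∀ T ∈ 𝒯, ∀ x, 0 < h T x)
    (hne : ∀ T ∈ 𝒯, T.Nonempty) {m : ℕ} (hex : ∃ T ∈ 𝒯, T.card = m)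
    (hmax : ∀ T ∈ 𝒯, T.card ≤ m) :
    ∃ C : ℝ, 0 < C ∧ Tendsto (fun L : ℝ =>
      (∫ x, if (∀ e, |x e| < 1) ∧ ∃ T ∈ 𝒯, x ∈ monomialSublevel T (h T) L then φ x else 0) /
        (Real.exp (-L) * L ^ (m - 1))) atTop (𝓝 C) := by
  have hpiece : ∀ T ∈ 𝒯, ∃ C : ℝ, (T.card = m → 0 < C) ∧ 0 ≤ C ∧ Tendsto (fun L : ℝ =>
      (∫ x, sublevelShare 𝒯 h φ T L x) / (Real.exp (-L) * L ^ (m - 1))) atTop (𝓝 C) := by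
    intro T hT
    obtain ⟨e₀, h₀⟩ := hne T hT
    obtain ⟨c, M, hc, hM, hF⟩ :=
      exists_supportedNear_sublevelShare hφ hT (hh T hT) (hpos T hT)
    by_cases hTm : T.card = m
    · obtain ⟨hint, hlim⟩ := tendsto_integral_div_of_supportedNear h₀ hc hM hF
        (measurable_sublevelShare hh hφ hT)
        (tendsto_sublevelShare_monomialChart hφ hh hpos hT h₀ (hTm ▸ hmax))
      rw [hTm] at hlim
      have hC : 0 < ∫ u, (limitRegion T e₀ (h T)).indicator
          (fun u => φ fun e => if e ∈ T then 0 else u e) u := by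
        rw [integral_pos_iff_support_of_nonneg
          (Set.indicator_nonneg fun u _ => (hφpos _).le) hint, Set.support_indicator]
        have h1 : Function.support (fun u : E → ℝ => φ fun e => if e ∈ T then 0 else u e) =
            Set.univ := by
          ext u
          simp [(hφpos _).ne']
        rw [h1, Set.inter_univ]
        refine (isOpen_limitRegion T e₀ (hh T hT)).measure_pos _ ⟨0, ?_⟩
        simp [limitRegion, offSum]
      exact ⟨_, fun _ => hC, hC.le, hlim⟩
    · exact ⟨0, fun h => absurd h hTm, le_rfl, tendsto_integral_div_zero_of_supportedNear h₀ hc hM hF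
        (lt_of_le_of_ne (hmax T hT) hTm)⟩
  choose! C hC1 hC0 hC using hpiece
  refine ⟨∑ T ∈ 𝒯, C T, ?_, ?_⟩
  · obtain ⟨T, hT, hTm⟩ := hex
    exact Finset.sum_pos' hC0 ⟨T, hT, hC1 T hT hTm⟩
  · refine (tendsto_finsetSum 𝒯 hC).congr fun L => ?_
    rw [← Finset.sum_div, ← integral_finsetSum]
    · simp only [sum_sublevelShare]
    · intro T hT
      obtain ⟨c, M, -, -, hF⟩ :=
        exists_supportedNear_sublevelShare hφ hT (hh T hT) (hpos T hT)
      have hcomp : volume (Set.Icc (fun _ : E => (-1 : ℝ)) fun _ => 1) < ⊤ :=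
        isCompact_Icc.measure_lt_top
      have h1 : IntegrableOn (sublevelShare 𝒯 h φ T L) (Set.Icc (fun _ : E => (-1 : ℝ)) fun _ => 1) :=
        Measure.integrableOn_of_bounded hcomp.ne
          (measurable_sublevelShare hh hφ hT L).aestronglyMeasurable
          (ae_of_all _ fun x => (hF L x).1)
      refine (integrableOn_iff_integrable_of_support_subset fun x hx => ?_).mp h1
      have h2 := ((hF L x).2 hx).1
      exact ⟨fun e => (abs_lt.mp (h2 e)).1.le, fun e => (abs_lt.mp (h2 e)).2.le⟩

end Union

/-- The version for an indexed family, whose members may share a monomial, and for a density given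
only on the cube `[-1, 1]^E`. -/
theorem exists_tendsto_setIntegral_iUnion {ι : Type*} [Fintype ι] (T : ι → Finset E)
    (hT : ∀ i, (T i).Nonempty) (h : ι → (E → ℝ) → ℝ) (hh : ∀ i, Continuous (h i))
    (hpos : ∀ i x, 0 < h i x) {φ : (E → ℝ) → ℝ}
    (hφ : ContinuousOn φ (Set.Icc (fun _ => -1) fun _ => 1))
    (hφpos : ∀ x ∈ Set.Icc (fun _ : E => (-1 : ℝ)) (fun _ => 1), 0 < φ x) {m : ℕ}
    (hex : ∃ i, (T i).card = m) (hmax : ∀ i, (T i).card ≤ m) :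
    ∃ C : ℝ, 0 < C ∧ Tendsto (fun L : ℝ =>
      (∫ x in {x | x ∈ Set.Icc (fun _ : E => (-1 : ℝ)) (fun _ => 1) ∧
        ∃ i, (∏ e ∈ T i, |x e|) * h i x ≤ Real.exp (-L)}, φ x) /
        (Real.exp (-L) * L ^ (m - 1))) atTop (𝓝 C) := by
  classical
  -- Members sharing the monomial `U` are merged by taking the minimum of their weights.
  let fib : Finset E → Finset ι := fun U => Finset.univ.filter fun i => T i = U
  let H : Finset E → (E → ℝ) → ℝ := fun U x =>
    if hU : (fib U).Nonempty then (fib U).inf' hU fun i => h i x else 1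
  have hfib : ∀ U ∈ Finset.univ.image T, (fib U).Nonempty := by
    intro U hU
    obtain ⟨i, -, hi⟩ := Finset.mem_image.mp hU
    exact ⟨i, by simp [fib, hi]⟩
  have hHc : ∀ U ∈ Finset.univ.image T, Continuous (H U) := by
    intro U hU
    simp only [H, dif_pos (hfib U hU)]
    exact Continuous.finset_inf'_apply _ fun i _ => hh i
  have hHpos : ∀ U ∈ Finset.univ.image T, ∀ x, 0 < H U x := by
    intro U hU x
    simp only [H, dif_pos (hfib U hU)]
    exact (Finset.lt_inf'_iff _).mpr fun i _ => hpos i x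
  -- The density is extended by clamping each coordinate to `[-1, 1]`.
  let clamp : (E → ℝ) → E → ℝ := fun x e => max (-1) (min 1 (x e))
  have hclamp : ∀ x, clamp x ∈ Set.Icc (fun _ : E => (-1 : ℝ)) fun _ => 1 :=
    fun x => ⟨fun e => le_max_left _ _, fun e => max_le (by norm_num) (min_le_left _ _)⟩
  have hclampc : Continuous clamp := by fun_prop
  obtain ⟨C, hC0, hC⟩ := exists_tendsto_integral_union (𝒯 := Finset.univ.image T) (h := H)
    (φ := φ ∘ clamp) (hφ.comp_continuous hclampc hclamp) (fun x => hφpos _ (hclamp x)) hHc hHpos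
    (by simpa using hT) (m := m) (by simpa using hex) (by simpa using hmax)
  refine ⟨C, hC0, hC.congr fun L => ?_⟩
  congr 1
  have hmem : ∀ x, (∃ U ∈ Finset.univ.image T, x ∈ monomialSublevel U (H U) L) ↔
      ∃ i, (∏ e ∈ T i, |x e|) * h i x ≤ Real.exp (-L) := by
    intro x
    have hnn : ∀ U : Finset E, 0 ≤ ∏ e ∈ U, |x e| :=
      fun U => Finset.prod_nonneg fun e _ => abs_nonneg _
    constructor
    · rintro ⟨U, hU, hx⟩
      obtain ⟨i, hi, hieq⟩ := Finset.exists_mem_eq_inf' (hfib U hU) fun i => h i x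
      have hTi : T i = U := (Finset.mem_filter.mp hi).2
      refine ⟨i, ?_⟩
      rw [monomialSublevel, Set.mem_ofPred_eq] at hx
      simp only [H, dif_pos (hfib U hU), hieq] at hx
      rwa [hTi]
    · rintro ⟨i, hi⟩
      have hU : T i ∈ Finset.univ.image T := Finset.mem_image_of_mem _ (Finset.mem_univ i)
      refine ⟨T i, hU, le_trans (mul_le_mul_of_nonneg_left ?_ (hnn _)) hi⟩
      simp only [H, dif_pos (hfib _ hU)]
      exact Finset.inf'_le _ (by simp [fib])
  simp only [hmem]
  have hs : MeasurableSet {x : E → ℝ | x ∈ Set.Icc (fun _ : E => (-1 : ℝ)) (fun _ => 1) ∧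
      ∃ i, (∏ e ∈ T i, |x e|) * h i x ≤ Real.exp (-L)} := by
    have h1 : MeasurableSet {x : E → ℝ | ∃ i, (∏ e ∈ T i, |x e|) * h i x ≤ Real.exp (-L)} := by
      rw [Set.ofPred_exists]
      exact MeasurableSet.iUnion fun i => measurableSet_monomialSublevel (T i) (hh i) L
    exact measurableSet_Icc.inter h1
  rw [← integral_indicator hs]
  refine integral_congr_ae ?_
  have hae : (Set.univ.pi fun _ : E => Set.Ioo (-1 : ℝ) 1) =ᵐ[volume]
      Set.Icc (fun _ : E => (-1 : ℝ)) (fun _ => 1) := Measure.univ_pi_Ioo_ae_eq_Icc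
  filter_upwards [hae.mem_iff] with x hx
  have hx' : (∀ e, |x e| < 1) ↔ x ∈ Set.Icc (fun _ : E => (-1 : ℝ)) (fun _ => 1) := by
    rw [← hx]
    simp [abs_lt]
  by_cases hxs : x ∈ {x : E → ℝ | x ∈ Set.Icc (fun _ : E => (-1 : ℝ)) (fun _ => 1) ∧
      ∃ i, (∏ e ∈ T i, |x e|) * h i x ≤ Real.exp (-L)}
  · have hcx : clamp x = x := funext fun e => by
      rw [show clamp x e = max (-1) (min 1 (x e)) from rfl, min_eq_right (hxs.1.2 e),
        max_eq_right (hxs.1.1 e)]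
    rw [Set.indicator_of_mem hxs, if_pos ⟨hx'.mpr hxs.1, hxs.2⟩, Function.comp_apply, hcx]
  · rw [Set.indicator_of_notMem hxs, if_neg fun hc => hxs ⟨hx'.mp hc.1, hc.2⟩]

end Pi

/-! ### The volume of the unfaithful parameters -/

theorem mainTheorem4 (p : ℕ) (hp : 2 ≤ p) (G : OrderedDAG p) (hG : G.IsDirectedTree)
    (m : ℕ) (hm : IsGreatest G.pathLengths m)
    (φ : (G.Edge → ℝ) → ℝ) (hφ_an : AnalyticOn ℝ φ G.paramCube)
    (hφ_pos : ∀ a ∈ G.paramCube, 0 < φ a) (hφ_prob : ∫ a in G.paramCube, φ a = 1) :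
    ∃ C : ℝ, 0 < C ∧
      Tendsto (fun t : ℝ =>
          (G.unfaithfulVolume φ t - C * t * (-Real.log t) ^ (m - 1)) /
            (C * t * (-Real.log t) ^ (m - 1)))
        (𝓝[>] 0) (𝓝 0) := by
  classical
  let ι : Type := {q : Finset (Fin p) × Fin p × Fin p // q.2.1 ≠ q.2.2 ∧
    ∃ w : G.skeleton.Walk q.2.1 q.2.2, w.IsPath ∧ ∀ x ∈ w.support, x ∉ q.1}
  have hι : ∀ q : ι, ∃ w : G.skeleton.Walk q.1.2.1 q.1.2.2, w.IsPath ∧ ∀ x ∈ w.support, x ∉ q.1.1 :=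
    fun q => q.2.2
  choose w hw hwS using hι
  choose g hgc hgp hg using fun q : ι =>
    hG.exists_abs_partialCorr_eq q.2.1 (w q) (hw q) (hwS q)
  have hcard : ∀ q : ι, (OrderedDAG.walkEdges (w q)).card = (w q).length :=
    fun q => OrderedDAG.card_walkEdges (hw q)
  -- There are at least two vertices, so some path has an edge.
  have hm1 : 1 ≤ m := by
    obtain ⟨v, hv⟩ := hG.1.connected.exists_isPath ⟨0, by omega⟩ (⟨1, by omega⟩ : Fin p)
    refine le_trans ?_ (hm.2 ⟨_, _, v, hv, rfl⟩)
    rw [Nat.one_le_iff_ne_zero]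
    intro h0
    simpa using SimpleGraph.Walk.eq_of_length_eq_zero h0
  obtain ⟨C, hC0, hC⟩ := exists_tendsto_setIntegral_iUnion
    (fun q : ι => OrderedDAG.walkEdges (w q))
    (fun q => by
      rw [← Finset.card_pos, hcard, Nat.pos_iff_ne_zero]
      exact fun h0 => q.2.1 (SimpleGraph.Walk.eq_of_length_eq_zero h0))
    g hgc hgp hφ_an.continuousOn hφ_pos (m := m)
    (by
      obtain ⟨i, j, v, hv, hvm⟩ := hm.1
      have hij : i ≠ j := by
        rintro rfl
        rw [SimpleGraph.Walk.isPath_iff_nil, ← SimpleGraph.Walk.length_eq_zero_iff] at hv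
        omega
      refine ⟨⟨(∅, i, j), hij, v, hv, by simp⟩, ?_⟩
      rw [hcard, ← hvm]
      exact congrArg SimpleGraph.Walk.length ((hG.1.existsUnique_path _ _).unique (hw _) hv))
    (fun q => by
      rw [hcard]
      exact hm.2 ⟨_, _, w q, hw q, rfl⟩)
  refine ⟨C, hC0, ?_⟩
  have hlog : Tendsto (fun t : ℝ => -Real.log t) (𝓝[>] 0) atTop :=
    tendsto_neg_atBot_atTop.comp Real.tendsto_log_nhdsGT_zero
  have hlim := ((hC.comp hlog).div_const C).sub_const 1
  rw [div_self hC0.ne', sub_self] at hlim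
  refine hlim.congr' ?_
  filter_upwards [self_mem_nhdsWithin, hlog.eventually_gt_atTop 0] with t ht htL
  have ht0 : 0 < t := ht
  have hset : {a | a ∈ G.paramCube ∧ ¬ G.StrongFaithful t a} =
      {x | x ∈ Set.Icc (fun _ : G.Edge => (-1 : ℝ)) (fun _ => 1) ∧
        ∃ q : ι, (∏ e ∈ OrderedDAG.walkEdges (w q), |x e|) * g q x ≤ Real.exp (-(-Real.log t))} := by
    ext a
    refine and_congr_right fun _ => ?_
    rw [neg_neg, Real.exp_log ht0, hG.not_strongFaithful_iff ht0.le]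
    constructor
    · rintro ⟨S, i, j, hij, hpath, hle⟩
      refine ⟨⟨(S, i, j), hij, hpath⟩, ?_⟩
      rwa [← Finset.abs_prod, ← hg ⟨(S, i, j), hij, hpath⟩ a]
    · rintro ⟨q, hq⟩
      refine ⟨q.1.1, q.1.2.1, q.1.2.2, q.2.1, q.2.2, ?_⟩
      rwa [hg q a, Finset.abs_prod]
  have hpos : 0 < t * (-Real.log t) ^ (m - 1) := mul_pos ht0 (pow_pos htL _)
  simp only [Function.comp_apply, OrderedDAG.unfaithfulVolume]
  rw [hset, neg_neg, Real.exp_log ht0, mul_assoc C, sub_div,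
    div_self (mul_pos hC0 hpos).ne', div_div, mul_comm C]
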